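/- There are absolute constants $C,C'>0$ such that the following holds. Let $n_1,n_2\ge 1$, let $A_\star\in\mathbb{R}^{n_1\times n_2}$, and consider noisy observations $Y_{ij}=A_{\star,ij}+\epsilon_{ij}$ of the entries with $T_{ij}=1$, where - the indicators $T_{ij}\in\{0,1\}$ are mutually independent with $\Pr(T_{ij}=1)=\pi_{ij}\ge \pi_L>0$; - the errors $\epsilon_{ij}$ are mutually independent, have mean zero, satisfy $\|\epsilon_{ij}\|_{\psi_2}\le\tau$ with $\|X\|_{\psi_2}=\inf\{t>0:\mathsf{E}\exp(X^2/t^2)\le 2\}$, and $\epsilon=(\epsilon_{ij})$ is independent of $T=(T_{ij})$. Write $\circ$ for the entrywise product, $J$ for the all-ones matrix, $\|\cdot\|$, $\|\cdot\|_F$, $\|\cdot\|_*$ for the spectral, Frobenius and nuclear norms, and $\|A\|_{\max}=\inf\{\|U\|_{2,\infty}\|V\|_{2,\infty}:A=UV^{\top}\}$, where $\|U\|_{2,\infty}$ is the largest Euclidean norm of a row of $U$. Put $$r=\min\left\{\frac{\log^{1/2}(n_1+n_2)}{\sqrt{\pi_L(n_1\wedge n_2)}},\ \frac{\sqrt{n_1+n_2}}{\pi_L\sqrt{n_1n_2}}\right\}.$$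 Assume $\|A_\star\|_{\max}\le\beta$, $\kappa\ge(2\sum_{i,j}\pi_{ij}^{-1})^{1/2}$, and $0\le\mu\le K\beta\, r/\sqrt{n_1n_2}$ for some $K\ge 0$. Let $\widehat W$ (a function of $T$) minimise $\|T\circ W-J\|$ over all $W$ with $\|T\circ W\|_F\le\kappa$ and $W_{ij}\ge 1$ for all $i,j$, and let $\widehat A$ be any minimiser of $$\frac{1}{n_1n_2}\left\|T\circ\widehat W^{\circ 1/2}\circ(Y-A)\right\|_F^2+\mu\|A\|_*$$ over all $A$ with $\|A\|_{\max}\le\beta$, where $\widehat W^{\circ 1/2}$ is the entrywise square root. Then, with probability at least $$1-\exp\Big\{-\tfrac{\log 2}{2}\,\pi_L^2\sum_{i,j}\pi_{ij}^{-1}\Big\}-2\exp\{-(n_1+n_2)\}-\frac{1}{n_1+n_2},$$ every such $\widehat A$ satisfies $$\frac{1}{n_1n_2}\|\widehat A-A_\star\|_F^2\le (C+K)\,\beta^2\,r+C'\,\frac{\beta\tau\kappa\sqrt{n_1+n_2}}{n_1n_2}.$$ -/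

import Mathlib

open MeasureTheory ProbabilityTheory
open scoped Matrix ENNReal

noncomputable section

namespace MatrixCompletion

/-- The Frobenius norm `‖A‖_F`. -/
def frobNorm {m n : ℕ} (A : Matrix (Fin m) (Fin n) ℝ) : ℝ :=
  Real.sqrt (∑ i, ∑ j, A i j ^ 2)

/-- The spectral norm `‖A‖`: the operator norm of `A` between Euclidean spaces. -/
def opNorm {m n : ℕ} (A : Matrix (Fin m) (Fin n) ℝ) : ℝ :=
  ‖LinearMap.toContinuousLinearMap (Matrix.toEuclideanLin A)‖

/-- The nuclear norm `‖A‖_*`: the sum of the singular values. An `m × n` matrix has at most `n`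
nonzero singular values. -/
def nuclearNorm {m n : ℕ} (A : Matrix (Fin m) (Fin n) ℝ) : ℝ :=
  ∑ k ∈ Finset.range n, (Matrix.toEuclideanLin A).singularValues k

/-- `‖U‖_{2,∞}`: the largest Euclidean norm of a row of `U`. -/
def twoInftyNorm {m k : ℕ} (U : Matrix (Fin m) (Fin k) ℝ) : ℝ :=
  ⨆ i, Real.sqrt (∑ l, U i l ^ 2)

/-- The max norm `‖A‖_max = inf {‖U‖_{2,∞} ‖V‖_{2,∞} : A = U Vᵀ}`. -/
def maxNorm {m n : ℕ} (A : Matrix (Fin m) (Fin n) ℝ) : ℝ :=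
  sInf {r : ℝ | ∃ (k : ℕ) (U : Matrix (Fin m) (Fin k) ℝ) (V : Matrix (Fin n) (Fin k) ℝ),
    A = U * Vᵀ ∧ r = twoInftyNorm U * twoInftyNorm V}

/-- The sub-Gaussian norm `‖X‖_{ψ₂} = inf {t > 0 : E exp(X² / t²) ≤ 2}`; it is `∞` when there is no
such `t`. -/
def psiTwoNorm {Ω : Type*} [MeasurableSpace Ω] (X : Ω → ℝ) (P : Measure Ω) : ℝ≥0∞ :=
  sInf {s : ℝ≥0∞ | ∃ t : ℝ, 0 < t ∧ s = ENNReal.ofReal t ∧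
    ∫⁻ ω, ENNReal.ofReal (Real.exp (X ω ^ 2 / t ^ 2)) ∂P ≤ 2}

/-- An observation pattern: all entries are `0` or `1`. -/
def IsMask {m n : ℕ} (T : Matrix (Fin m) (Fin n) ℝ) : Prop :=
  ∀ i j, T i j = 0 ∨ T i j = 1

/-- The feasible weights: `‖T ∘ W‖_F ≤ κ` and `W_{ij} ≥ 1` for all `i, j`. -/
def feasibleWeights {m n : ℕ} (κ : ℝ) (T : Matrix (Fin m) (Fin n) ℝ) :
    Set (Matrix (Fin m) (Fin n) ℝ) :=
  {W | frobNorm (T ⊙ W) ≤ κ ∧ ∀ i j, 1 ≤ W i j}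

/-- `W` is a balancing weight matrix for the pattern `T`: it minimises `‖T ∘ W - J‖`, with `J` the
all-ones matrix, among the feasible weights. -/
def IsBalancingWeight {m n : ℕ} (κ : ℝ) (T W : Matrix (Fin m) (Fin n) ℝ) : Prop :=
  W ∈ feasibleWeights κ T ∧
    IsMinOn (fun W' => opNorm (T ⊙ W' - Matrix.of fun _ _ => 1)) (feasibleWeights κ T) W

/-- The objective `(mn)⁻¹ ‖T ∘ W^{∘1/2} ∘ (Y - A)‖_F² + μ ‖A‖_*`. -/
def objective {m n : ℕ} (μ : ℝ) (T W Y A : Matrix (Fin m) (Fin n) ℝ) : ℝ :=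
  frobNorm (T ⊙ W.map Real.sqrt ⊙ (Y - A)) ^ 2 / ((m : ℝ) * n) + μ * nuclearNorm A

/-- `A` is the weighted estimator: it minimises the objective on the max-norm ball of radius `β`. -/
def IsEstimator {m n : ℕ} (β μ : ℝ) (T W Y A : Matrix (Fin m) (Fin n) ℝ) : Prop :=
  maxNorm A ≤ β ∧ IsMinOn (objective μ T W Y) {B | maxNorm B ≤ β} A

/-- The rate `min {log^{1/2}(m+n) / √(π_L (m ∧ n)), √(m+n) / (π_L √(mn))}`. -/
def rate (m n : ℕ) (πL : ℝ) : ℝ :=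
  min (Real.sqrt (Real.log ((m : ℝ) + n)) / Real.sqrt (πL * min (m : ℝ) n))
    (Real.sqrt ((m : ℝ) + n) / (πL * Real.sqrt ((m : ℝ) * n)))

end MatrixCompletion

end

set_option linter.unusedSectionVars false

namespace MatrixCompletion

/-! ### Trace inequalities for powers of two symmetric matrices. -/

section Spectral

variable {ι : Type*} [Fintype ι] [DecidableEq ι]

/-! Write W for the balancing weights at T and Δ = Â − A⋆. Comparing the objective at Â and at A⋆
and expanding the squares gives (`IsEstimator.basic_inequality`) ‖Δ‖_F² ≤ −⟨T∘W − J, Δ∘Δ⟩ + 2⟨T∘W∘ε,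
Δ⟩ + n₁n₂ μ ‖A⋆‖_*. Each term is controlled by a duality for the max norm.

Balancing term. Row-wise tensor products of factors show that the max norm is submultiplicative
under entrywise products, and a matrix of max norm γ pairs with M to at most √(n₁n₂) ‖M‖ γ. So the
term is at most 4 √(n₁n₂) ‖T∘W − J‖ β² (`pairing_hadamard_sub_sq_le`). As W minimises ‖T∘W − J‖, it
does at least as well as the inverse probabilities 1/π_ij, which are feasible off an event bounded
by Chernoff's method (`bernExp_sum_inv_sq_tail_le`). For those weights T∘W − J has independent
centred entries. Its spectral norm is bounded twice, matching the two members of the minimum r: by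
moments of order about log(n₁ + n₂) and a matrix Rosenthal inequality for the Hermitian dilation
(`bernExp_opNorm_devMatrix_moment`), and by nets and Hoeffding's inequality
(`bernExp_opNorm_devMatrix_net`). The first needs r < 1; if r ≥ 1 the claim is trivial, since
entries of Δ are at most 2β in modulus.

Noise term. By Grothendieck's inequality (`grothendieck`) a linear form on the max-norm ball is, up
to a constant, maximal at a sign matrix s tᵀ, so only 2^(n₁+n₂) forms matter. Given T the weights
are fixed, and the coefficients of each form have Euclidean norm ‖T∘W‖_F ≤ κ whatever the signs. A
sub-Gaussian tail at level 3 √(n₁+n₂) τκ beats the union bound (`measureReal_noise_le`).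

Penalty. ‖A⋆‖_* ≤ √(n₁n₂) β (`nuclearNorm_le_of_maxNorm_le`), so the condition on μ makes this term
at most n₁n₂ K β² r. -/

theorem pow_eq_eigenvectorUnitary {X : Matrix ι ι ℝ} (hX : X.IsHermitian) (a : ℕ) :
    X ^ a = (hX.eigenvectorUnitary : Matrix ι ι ℝ) *
      Matrix.diagonal (fun k => hX.eigenvalues k ^ a) *
      star (hX.eigenvectorUnitary : Matrix ι ι ℝ) := by
  conv_lhs => rw [hX.spectral_theorem, ← map_pow, Matrix.diagonal_pow,
    Unitary.conjStarAlgAut_apply]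
  rfl

/-- The traces of mixed powers of two symmetric matrices are mixed moments of a joint spectral
measure. -/
theorem exists_joint_spectral {X Y : Matrix ι ι ℝ} (hX : X.IsHermitian) (hY : Y.IsHermitian) :
    ∃ o : ι → ι → ℝ, (∀ k l, 0 ≤ o k l) ∧ (∀ k, ∑ l, o k l = 1) ∧
      ∀ a b : ℕ, (X ^ a * Y ^ b).trace =
        ∑ k, ∑ l, o k l * (hX.eigenvalues k ^ a * hY.eigenvalues l ^ b) := by
  set U := (hX.eigenvectorUnitary : Matrix ι ι ℝ) with hU
  set W := (hY.eigenvectorUnitary : Matrix ι ι ℝ) with hW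
  have hUU : star U * U = 1 := Unitary.coe_star_mul_self _
  have hWW : W * star W = 1 := Unitary.coe_mul_star_self _
  have hQ : (star U * W) * (star U * W)ᵀ = 1 := by
    have : (star U * W)ᵀ = star W * U := by
      simp [Matrix.star_eq_conjTranspose, Matrix.transpose_mul]
    rw [this, Matrix.mul_assoc, ← Matrix.mul_assoc W, hWW, Matrix.one_mul, hUU]
  -- The joint measure consists of the squared overlaps of the two eigenbases. Its rows sum to 1
  -- because the overlap matrix is orthogonal.
  refine ⟨fun k l => (star U * W) k l ^ 2, fun k l => sq_nonneg _, fun k => ?_, fun a b => ?_⟩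
  · have := congrFun (congrFun hQ k) k
    rw [Matrix.mul_apply, Matrix.one_apply_eq] at this
    simpa only [Matrix.transpose_apply, ← sq] using this
  · rw [pow_eq_eigenvectorUnitary hX, pow_eq_eigenvectorUnitary hY, ← hU, ← hW]
    have e : U * Matrix.diagonal (fun k => hX.eigenvalues k ^ a) * star U *
        (W * Matrix.diagonal (fun k => hY.eigenvalues k ^ b) * star W) =
        U * (Matrix.diagonal (fun k => hX.eigenvalues k ^ a) * (star U * W) *
          Matrix.diagonal (fun k => hY.eigenvalues k ^ b) * star W) := by
      simp only [Matrix.mul_assoc]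
    rw [e, Matrix.trace_mul_comm, Matrix.mul_assoc _ (star W) U]
    have h2 : star W * U = (star U * W)ᵀ := by
      simp [Matrix.star_eq_conjTranspose, Matrix.transpose_mul]
    rw [h2, Matrix.trace]
    refine Finset.sum_congr rfl fun k _ => ?_
    rw [Matrix.diag_apply, Matrix.mul_apply]
    refine Finset.sum_congr rfl fun l _ => ?_
    rw [Matrix.mul_diagonal, Matrix.diagonal_mul, Matrix.transpose_apply]
    ring

/-- For nonnegative x, y this is (x^q − y^q)(x^s − y^s) ≥ 0. An even total degree lets the right
side absorb absolute values. -/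
theorem pow_mul_pow_add_le {x y : ℝ} {q s : ℕ} (hqs : Even (q + s)) :
    x ^ q * y ^ s + x ^ s * y ^ q ≤ x ^ (q + s) + y ^ (q + s) := by
  have key : ∀ x y : ℝ, 0 ≤ x → 0 ≤ y →
      x ^ q * y ^ s + x ^ s * y ^ q ≤ x ^ (q + s) + y ^ (q + s) := by
    intro x y hx hy
    have : 0 ≤ (x ^ q - y ^ q) * (x ^ s - y ^ s) := by
      rcases le_total x y with h | h
      · exact mul_nonneg_of_nonpos_of_nonpos (sub_nonpos.2 (pow_le_pow_left₀ hx h q))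
          (sub_nonpos.2 (pow_le_pow_left₀ hx h s))
      · exact mul_nonneg (sub_nonneg.2 (pow_le_pow_left₀ hy h q))
          (sub_nonneg.2 (pow_le_pow_left₀ hy h s))
    rw [pow_add, pow_add]
    linarith
  have h := key |x| |y| (abs_nonneg _) (abs_nonneg _)
  rw [hqs.pow_abs, hqs.pow_abs] at h
  refine le_trans (add_le_add ?_ ?_) h <;>
  · rw [← abs_pow, ← abs_pow, ← abs_mul]
    exact le_abs_self _

/-- A mean value inequality for odd powers. -/
theorem sub_mul_pow_sub_pow_le (x y : ℝ) {r : ℕ} (hr : Even r) :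
    (x - y) * (x ^ (r + 1) - y ^ (r + 1)) ≤
      ((r : ℝ) + 1) / 2 * ((x - y) ^ 2 * (x ^ r + y ^ r)) := by
  have hs : 2 * ∑ q ∈ Finset.range (r + 1), x ^ q * y ^ (r - q) ≤
      ((r : ℝ) + 1) * (x ^ r + y ^ r) := by
    have h1 : ∑ q ∈ Finset.range (r + 1), x ^ q * y ^ (r - q) =
        ∑ q ∈ Finset.range (r + 1), x ^ (r - q) * y ^ q := by
      rw [← Finset.sum_range_reflect]
      refine Finset.sum_congr rfl fun q hq => ?_
      have : q ≤ r := Nat.lt_succ_iff.1 (Finset.mem_range.1 hq)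
      congr 2
      omega
    have h2 : ∀ q ∈ Finset.range (r + 1),
        x ^ q * y ^ (r - q) + x ^ (r - q) * y ^ q ≤ x ^ r + y ^ r := by
      intro q hq
      have hq' : q + (r - q) = r := by
        have := Finset.mem_range.1 hq
        omega
      have := pow_mul_pow_add_le (x := x) (y := y) (q := q) (s := r - q) (by rwa [hq'])
      rwa [hq'] at this
    have h3 := Finset.sum_le_sum h2
    rw [Finset.sum_add_distrib, ← h1, Finset.sum_const, Finset.card_range, nsmul_eq_mul] at h3
    push_cast at h3
    linarith
  have hg : (∑ q ∈ Finset.range (r + 1), x ^ q * y ^ (r - q)) * (x - y) =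
      x ^ (r + 1) - y ^ (r + 1) := by
    have := geom_sum₂_mul x y (r + 1)
    simpa using this
  rw [← hg]
  nlinarith [sq_nonneg (x - y)]

/-- The trace version of the mean value inequality for odd powers. -/
theorem trace_sub_mul_pow_sub_pow_le {X Y : Matrix ι ι ℝ} (hX : X.IsHermitian)
    (hY : Y.IsHermitian) {r : ℕ} (hr : Even r) :
    ((X - Y) * (X ^ (r + 1) - Y ^ (r + 1))).trace ≤
      ((r : ℝ) + 1) / 2 * (((X - Y) ^ 2 * X ^ r).trace + ((X - Y) ^ 2 * Y ^ r).trace) := by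
  obtain ⟨o, ho, -, h⟩ := exists_joint_spectral hX hY
  have e1 : ((X - Y) * (X ^ (r + 1) - Y ^ (r + 1))).trace =
      (X ^ (r + 2) * Y ^ 0).trace - (X ^ 1 * Y ^ (r + 1)).trace - (X ^ (r + 1) * Y ^ 1).trace +
        (X ^ 0 * Y ^ (r + 2)).trace := by
    rw [sub_mul, mul_sub, mul_sub, Matrix.trace_sub, Matrix.trace_sub, Matrix.trace_sub,
      Matrix.trace_mul_comm Y]
    simp only [pow_zero, mul_one, one_mul, pow_one, ← pow_succ']
    ring
  have e2 : ((X - Y) ^ 2 * X ^ r).trace = (X ^ (r + 2) * Y ^ 0).trace -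
      2 * (X ^ (r + 1) * Y ^ 1).trace + (X ^ r * Y ^ 2).trace := by
    have : (X - Y) ^ 2 * X ^ r = X * X * X ^ r - X * (Y * X ^ r) - Y * (X * X ^ r)
        + Y ^ 2 * X ^ r := by noncomm_ring
    rw [this, Matrix.trace_add, Matrix.trace_sub, Matrix.trace_sub, Matrix.trace_mul_comm X,
      Matrix.trace_mul_comm Y, Matrix.trace_mul_comm (Y ^ 2), Matrix.mul_assoc Y,
      Matrix.trace_mul_comm Y, ← pow_succ', ← pow_succ, mul_assoc, ← pow_succ', ← pow_succ']
    simp only [pow_zero, mul_one, pow_one]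
    ring
  have e3 : ((X - Y) ^ 2 * Y ^ r).trace = (X ^ 2 * Y ^ r).trace -
      2 * (X ^ 1 * Y ^ (r + 1)).trace + (X ^ 0 * Y ^ (r + 2)).trace := by
    have : (X - Y) ^ 2 * Y ^ r = X ^ 2 * Y ^ r - X * (Y * Y ^ r) - Y * (X * Y ^ r)
        + Y * (Y * Y ^ r) := by noncomm_ring
    rw [this, Matrix.trace_add, Matrix.trace_sub, Matrix.trace_sub,
      Matrix.trace_mul_comm Y (X * Y ^ r), mul_assoc X, ← pow_succ, ← pow_succ', ← pow_succ']
    simp only [pow_zero, one_mul, pow_one]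
    ring
  rw [e1, e2, e3]
  simp only [h, Finset.mul_sum, ← Finset.sum_sub_distrib, ← Finset.sum_add_distrib]
  refine Finset.sum_le_sum fun k _ => Finset.sum_le_sum fun l _ => ?_
  have := mul_le_mul_of_nonneg_left
    (sub_mul_pow_sub_pow_le (hX.eigenvalues k) (hY.eigenvalues l) hr) (ho k l)
  ring_nf at this ⊢
  linarith

/-- A trace version of Young's inequality. -/
theorem trace_mul_pow_le {X V : Matrix ι ι ℝ} (hX : X.IsHermitian) (hV : V.PosSemidef)
    {c : ℝ} (hc : 0 < c) (p : ℕ) :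
    (V * X ^ (2 * p)).trace ≤ c⁻¹ * (X ^ (2 * (p + 1))).trace + c ^ p * (V ^ (p + 1)).trace := by
  obtain ⟨o, ho, -, h⟩ := exists_joint_spectral hX hV.isHermitian
  have e1 : (V * X ^ (2 * p)).trace = (X ^ (2 * p) * V ^ 1).trace := by
    rw [Matrix.trace_mul_comm, pow_one]
  have e2 : (X ^ (2 * (p + 1))).trace = (X ^ (2 * (p + 1)) * V ^ 0).trace := by simp
  have e3 : (V ^ (p + 1)).trace = (X ^ 0 * V ^ (p + 1)).trace := by simp
  rw [e1, e2, e3]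
  simp only [h, Finset.mul_sum, ← Finset.sum_add_distrib]
  refine Finset.sum_le_sum fun k _ => Finset.sum_le_sum fun l _ => ?_
  set x := hX.eigenvalues k ^ 2
  set v := hV.isHermitian.eigenvalues l
  have hx : 0 ≤ x := sq_nonneg _
  have hv : 0 ≤ v := hV.eigenvalues_nonneg l
  -- Scalar Young inequality with explicit constants: whichever of v and x/c is larger, one of the
  -- two terms alone dominates.
  have key : x ^ p * v ≤ c⁻¹ * x ^ (p + 1) + c ^ p * v ^ (p + 1) := by
    rcases le_total v (c⁻¹ * x) with hle | hle
    · have : x ^ p * v ≤ x ^ p * (c⁻¹ * x) := mul_le_mul_of_nonneg_left hle (by positivity)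
      have h0 : 0 ≤ c ^ p * v ^ (p + 1) := by positivity
      calc x ^ p * v ≤ x ^ p * (c⁻¹ * x) := this
        _ = c⁻¹ * x ^ (p + 1) := by ring
        _ ≤ _ := by linarith
    · have h1 : x ≤ c * v := by
        have := mul_le_mul_of_nonneg_left hle hc.le
        rwa [← mul_assoc, mul_inv_cancel₀ hc.ne', one_mul] at this
      have h0 : 0 ≤ c⁻¹ * x ^ (p + 1) := by positivity
      calc x ^ p * v ≤ (c * v) ^ p * v :=
            mul_le_mul_of_nonneg_right (pow_le_pow_left₀ hx h1 p) hv
        _ = c ^ p * v ^ (p + 1) := by ring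
        _ ≤ _ := by linarith
  have := mul_le_mul_of_nonneg_left key (ho k l)
  simp only [pow_mul, pow_zero, pow_one, mul_one, one_mul]
  linarith

/-- A quadratic form of `X ^ 2` is bounded through the trace of a power of `X`. -/
theorem dotProduct_mulVec_sq_le {X : Matrix ι ι ℝ} (hX : X.IsHermitian) {p : ℕ} (hp : p ≠ 0)
    {t : ℝ} (ht : 0 ≤ t) (h : (X ^ (2 * p)).trace ≤ t ^ p) (z : ι → ℝ) :
    (X *ᵥ z) ⬝ᵥ (X *ᵥ z) ≤ t * (z ⬝ᵥ z) := by
  -- The quadratic form is the trace of X² against the rank-one matrix z zᵀ, so the joint spectral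
  -- formula applies to this pair.
  have hZ : (Matrix.vecMulVec z z).PosSemidef := by
    simpa using Matrix.posSemidef_vecMulVec_self_star z
  obtain ⟨o, ho, ho1, hjoint⟩ := exists_joint_spectral hX hZ.isHermitian
  have hle : ∀ k, hX.eigenvalues k ^ 2 ≤ t := by
    intro k
    refine le_of_pow_le_pow_left₀ hp ht (le_trans ?_ h)
    have e := hjoint (2 * p) 0
    simp only [pow_zero, mul_one, ← Finset.sum_mul, ho1, one_mul] at e
    rw [e, ← pow_mul]
    exact Finset.single_le_sum (f := fun k => hX.eigenvalues k ^ (2 * p))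
      (fun j _ => (even_two_mul p).pow_nonneg _) (Finset.mem_univ k)
  have hXt : Xᵀ = X := by simpa [Matrix.IsHermitian] using hX.eq
  have e1 : (X *ᵥ z) ⬝ᵥ (X *ᵥ z) = (X ^ 2 * Matrix.vecMulVec z z ^ 1).trace := by
    rw [pow_one, Matrix.mul_vecMulVec, Matrix.trace_vecMulVec, sq, ← Matrix.mulVec_mulVec,
      Matrix.dotProduct_mulVec, ← Matrix.mulVec_transpose, hXt]
  have e2 : z ⬝ᵥ z = (X ^ 0 * Matrix.vecMulVec z z ^ 1).trace := by
    rw [pow_zero, one_mul, pow_one, Matrix.trace_vecMulVec]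
  rw [e1, e2, hjoint, hjoint]
  simp only [Finset.mul_sum]
  refine Finset.sum_le_sum fun k _ => Finset.sum_le_sum fun l _ => ?_
  have := mul_le_mul_of_nonneg_left (hle k) (mul_nonneg (ho k l) (hZ.eigenvalues_nonneg l))
  simp only [pow_zero, pow_one]
  linarith

end Spectral

/-! ### Finite Bernoulli expectations and moments of matrix series. -/

section Bernoulli

variable {κ : Type*} [Fintype κ] [DecidableEq κ]

/-- The probability of the pattern `S` under independent Bernoulli variables with parameters
`q`. -/
noncomputable def bernWeight (q : κ → ℝ) (S : κ → Bool) : ℝ :=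
  ∏ k, if S k then q k else 1 - q k

/-- The expectation of `F` under independent Bernoulli variables with parameters `q`. -/
noncomputable def bernExp (q : κ → ℝ) (F : (κ → Bool) → ℝ) : ℝ :=
  ∑ S, bernWeight q S * F S

theorem bernWeight_nonneg {q : κ → ℝ} (h0 : ∀ k, 0 ≤ q k) (h1 : ∀ k, q k ≤ 1) (S : κ → Bool) :
    0 ≤ bernWeight q S :=
  Finset.prod_nonneg fun k _ => by
    split_ifs
    · exact h0 k
    · linarith [h1 k]

theorem bernExp_prod (q : κ → ℝ) (φ : κ → Bool → ℝ) :
    bernExp q (fun S => ∏ k, φ k (S k)) = ∏ k, (q k * φ k true + (1 - q k) * φ k false) := by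
  have h : ∀ k, q k * φ k true + (1 - q k) * φ k false =
      ∑ b : Bool, (if b then q k else 1 - q k) * φ k b := fun k => by simp
  simp only [h, Finset.prod_univ_sum, bernExp, bernWeight, ← Finset.prod_mul_distrib]
  rw [Fintype.piFinset_univ]

theorem bernExp_const (q : κ → ℝ) (c : ℝ) : bernExp q (fun _ => c) = c := by
  have h := bernExp_prod q (fun _ _ => 1)
  simp only [Finset.prod_const_one, mul_one, add_sub_cancel] at h
  have h2 : ∑ S, bernWeight q S = 1 := by simpa [bernExp] using h
  simp [bernExp, ← Finset.sum_mul, h2]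

theorem bernExp_mono {q : κ → ℝ} (h0 : ∀ k, 0 ≤ q k) (h1 : ∀ k, q k ≤ 1)
    {F G : (κ → Bool) → ℝ} (h : ∀ S, F S ≤ G S) : bernExp q F ≤ bernExp q G :=
  Finset.sum_le_sum fun S _ => mul_le_mul_of_nonneg_left (h S) (bernWeight_nonneg h0 h1 S)

theorem bernExp_add (q : κ → ℝ) (F G : (κ → Bool) → ℝ) :
    bernExp q (fun S => F S + G S) = bernExp q F + bernExp q G := by
  simp [bernExp, mul_add, Finset.sum_add_distrib]

theorem bernExp_const_mul (q : κ → ℝ) (c : ℝ) (F : (κ → Bool) → ℝ) :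
    bernExp q (fun S => c * F S) = c * bernExp q F := by
  simp only [bernExp, Finset.mul_sum]
  exact Finset.sum_congr rfl fun S _ => by ring

theorem bernExp_sum (q : κ → ℝ) {α : Type*} (s : Finset α) (F : α → (κ → Bool) → ℝ) :
    bernExp q (fun S => ∑ a ∈ s, F a S) = ∑ a ∈ s, bernExp q (F a) := by
  simp only [bernExp, Finset.mul_sum]
  exact Finset.sum_comm

/-- The centred and rescaled Bernoulli variable `1{b} / q - 1`. -/
noncomputable def bernDev (q : ℝ) (b : Bool) : ℝ := (if b then q⁻¹ else 0) - 1

/-- Conditioning on all coordinates but k: patterns pair off under flipping the k-th coordinate, and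
the two members of a pair have weights q k and 1 − q k times a common factor. -/
theorem bernExp_le_of_pairs {q : κ → ℝ} (h0 : ∀ k, 0 ≤ q k) (h1 : ∀ k, q k ≤ 1) (k : κ)
    {F G : (κ → Bool) → ℝ}
    (h : ∀ S, S k = true → q k * F S + (1 - q k) * F (Function.update S k false) ≤
      q k * G S + (1 - q k) * G (Function.update S k false)) :
    bernExp q F ≤ bernExp q G := by
  set flip : (κ → Bool) → (κ → Bool) := fun S => Function.update S k (!S k) with hflip
  have hinv : Function.Involutive flip := fun S => by simp [hflip]
  have hsum : ∀ H : (κ → Bool) → ℝ, ∑ S, H (flip S) = ∑ S, H S := fun H =>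
    Equiv.sum_comp hinv.toPerm H
  set H : (κ → Bool) → ℝ := fun S => bernWeight q S * G S - bernWeight q S * F S with hH
  have hpair : ∀ S, S k = true → 0 ≤ H S + H (flip S) := by
    intro S hS
    have hf : flip S = Function.update S k false := by simp [hflip, hS]
    set c : ℝ := ∏ j ∈ Finset.univ.erase k, (if S j then q j else 1 - q j)
    have hc : 0 ≤ c := Finset.prod_nonneg fun j _ => by
      split_ifs
      · exact h0 j
      · linarith [h1 j]
    have w1 : bernWeight q S = q k * c := by
      rw [bernWeight, ← Finset.mul_prod_erase _ _ (Finset.mem_univ k)]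
      simp [hS, c]
    have w2 : bernWeight q (Function.update S k false) = (1 - q k) * c := by
      rw [bernWeight, ← Finset.mul_prod_erase _ _ (Finset.mem_univ k)]
      congr 1
      · simp
      · refine Finset.prod_congr rfl fun j hj => ?_
        rw [Function.update_of_ne (Finset.ne_of_mem_erase hj)]
    simp only [hH, hf, w1, w2]
    nlinarith [mul_le_mul_of_nonneg_left (h S hS) hc]
  have hall : ∀ S, 0 ≤ H S + H (flip S) := by
    intro S
    cases hS : S k with
    | true => exact hpair S hS
    | false =>
      have := hpair (flip S) (by simp [hflip, hS])
      rw [hinv S] at this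
      linarith
  have h2 : 0 ≤ ∑ S, (H S + H (flip S)) := Finset.sum_nonneg fun S _ => hall S
  rw [Finset.sum_add_distrib, hsum] at h2
  have h3 : ∑ S, H S = bernExp q G - bernExp q F := by
    simp [hH, bernExp, Finset.sum_sub_distrib]
  linarith

variable {ι : Type*} [Fintype ι] [DecidableEq ι]

/-- The random matrix series `∑ₖ (1{S k} / qₖ - 1) Aₖ`. -/
noncomputable def bernSeries (q : κ → ℝ) (A : κ → Matrix ι ι ℝ) (S : κ → Bool) : Matrix ι ι ℝ :=
  ∑ k, bernDev (q k) (S k) • A k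

theorem bernSeries_isHermitian (q : κ → ℝ) {A : κ → Matrix ι ι ℝ} (hA : ∀ k, (A k).IsHermitian)
    (S : κ → Bool) : (bernSeries q A S).IsHermitian := by
  rw [bernSeries, Matrix.IsHermitian, Matrix.conjTranspose_sum]
  exact Finset.sum_congr rfl fun k _ => by
    rw [Matrix.conjTranspose_smul, (hA k).eq, star_trivial]

theorem bernSeries_sub_update (q : κ → ℝ) (A : κ → Matrix ι ι ℝ) {S : κ → Bool} {k : κ}
    (hS : S k = true) :
    bernSeries q A S - bernSeries q A (Function.update S k false) = (q k)⁻¹ • A k := by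
  rw [bernSeries, bernSeries, ← Finset.sum_sub_distrib, Finset.sum_eq_single k]
  · rw [← sub_smul]
    simp [bernDev, hS]
  · intro j _ hj
    rw [Function.update_of_ne hj, sub_self]
  · simp

/-- The conditional variance proxy of `bernSeries`. -/
noncomputable def bernVar (q : κ → ℝ) (A : κ → Matrix ι ι ℝ) (S : κ → Bool) : Matrix ι ι ℝ :=
  ∑ k, ((bernDev (q k) (S k) ^ 2 + (1 - q k) / q k) / 2) • A k ^ 2

/-- One factor of the series is split off and its k-th coordinate integrated with the others fixed.
Centring leaves (1 − q) tr A(X^(2p+1) − Y^(2p+1)), where X − Y = A/q, and the trace mean value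
inequality bounds it. The coefficients in `bernVar` are chosen so that the result matches the right
side exactly. -/
theorem bernExp_trace_pow_le {q : κ → ℝ} (h0 : ∀ k, 0 < q k) (h1 : ∀ k, q k ≤ 1)
    {A : κ → Matrix ι ι ℝ} (hA : ∀ k, (A k).IsHermitian) (p : ℕ) :
    bernExp q (fun S => (bernSeries q A S ^ (2 * (p + 1))).trace) ≤
      (2 * p + 1) * bernExp q (fun S => (bernVar q A S * bernSeries q A S ^ (2 * p)).trace) := by
  have e1 : ∀ S, (bernSeries q A S ^ (2 * (p + 1))).trace =
      ∑ k, bernDev (q k) (S k) * (A k * bernSeries q A S ^ (2 * p + 1)).trace := by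
    intro S
    rw [show 2 * (p + 1) = 2 * p + 1 + 1 by ring, pow_succ']
    nth_rw 1 [bernSeries]
    rw [Finset.sum_mul, Matrix.trace_sum]
    exact Finset.sum_congr rfl fun k _ => by
      rw [Matrix.smul_mul, Matrix.trace_smul, smul_eq_mul]
  have e2 : ∀ S, (bernVar q A S * bernSeries q A S ^ (2 * p)).trace =
      ∑ k, (bernDev (q k) (S k) ^ 2 + (1 - q k) / q k) / 2 *
        (A k ^ 2 * bernSeries q A S ^ (2 * p)).trace := by
    intro S
    rw [bernVar, Finset.sum_mul, Matrix.trace_sum]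
    exact Finset.sum_congr rfl fun k _ => by
      rw [Matrix.smul_mul, Matrix.trace_smul, smul_eq_mul]
  simp only [e1, e2, bernExp_sum, Finset.mul_sum]
  refine Finset.sum_le_sum fun k _ => ?_
  rw [← bernExp_const_mul]
  refine bernExp_le_of_pairs (fun k => (h0 k).le) h1 k fun S hS => ?_
  have hq := h0 k
  have hX := bernSeries_isHermitian q hA S
  have hY := bernSeries_isHermitian q hA (Function.update S k false)
  have hXY := bernSeries_sub_update q A hS
  have main := trace_sub_mul_pow_sub_pow_le hX hY (even_two_mul p)
  set X := bernSeries q A S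
  set Y := bernSeries q A (Function.update S k false)
  rw [hXY, smul_pow, Matrix.smul_mul, Matrix.smul_mul, Matrix.smul_mul, Matrix.mul_sub,
    Matrix.trace_smul, Matrix.trace_smul, Matrix.trace_smul, Matrix.trace_sub] at main
  simp only [smul_eq_mul] at main
  simp only [Function.update_self, hS, bernDev, if_true, Bool.false_eq_true, if_false]
  set f := (A k * X ^ (2 * p + 1)).trace
  set f' := (A k * Y ^ (2 * p + 1)).trace
  set g := (A k ^ 2 * X ^ (2 * p)).trace
  set g' := (A k ^ 2 * Y ^ (2 * p)).trace
  push_cast at main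
  have h2 := mul_le_mul_of_nonneg_left main
    (mul_nonneg hq.le (sub_nonneg.2 (h1 k)))
  have e3 : q k * (1 - q k) * ((q k)⁻¹ * (f - f')) = (1 - q k) * (f - f') := by
    field_simp
  have e4 : q k * (((q k)⁻¹ - 1) * f) + (1 - q k) * ((0 - 1) * f') = (1 - q k) * (f - f') := by
    field_simp
    ring
  rw [e4, ← e3]
  refine h2.trans (le_of_eq ?_)
  field_simp
  ring

/-- A matrix Rosenthal inequality for Bernoulli series. -/
theorem bernExp_trace_pow_le_trace_bernVar {q : κ → ℝ} (h0 : ∀ k, 0 < q k) (h1 : ∀ k, q k ≤ 1)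
    {A : κ → Matrix ι ι ℝ} (hA : ∀ k, (A k).IsHermitian) (p : ℕ) :
    bernExp q (fun S => (bernSeries q A S ^ (2 * (p + 1))).trace) ≤
      (4 * p + 2) ^ (p + 1) * bernExp q (fun S => (bernVar q A S ^ (p + 1)).trace) := by
  have hV : ∀ S, (bernVar q A S).PosSemidef := by
    intro S
    refine Matrix.posSemidef_sum _ fun k _ => ?_
    have h : (A k ^ 2).PosSemidef := by
      have := Matrix.posSemidef_conjTranspose_mul_self (A k)
      rwa [(hA k).eq, ← sq] at this
    refine h.smul ?_
    have := div_nonneg (sub_nonneg.2 (h1 k)) (h0 k).le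
    positivity
  -- With c = 2(2p + 1) in Young's inequality, half of the left side reappears on the right and is
  -- absorbed.
  have hc : (0 : ℝ) < 4 * p + 2 := by positivity
  have h2 := bernExp_mono (fun k => (h0 k).le) h1 fun S =>
    trace_mul_pow_le (bernSeries_isHermitian q hA S) (hV S) hc p
  rw [bernExp_add, bernExp_const_mul, bernExp_const_mul] at h2
  have h3 := bernExp_trace_pow_le h0 h1 hA p
  have h4 := mul_le_mul_of_nonneg_left h2 (by positivity : (0 : ℝ) ≤ 2 * p + 1)
  have e : (2 * (p : ℝ) + 1) * ((4 * (p : ℝ) + 2)⁻¹ *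
      bernExp q (fun S => (bernSeries q A S ^ (2 * (p + 1))).trace)) =
      bernExp q (fun S => (bernSeries q A S ^ (2 * (p + 1))).trace) / 2 := by
    field_simp
    ring
  rw [mul_add, e] at h4
  have e5 : (4 * (p : ℝ) + 2) ^ (p + 1) * bernExp q (fun S => (bernVar q A S ^ (p + 1)).trace) =
    2 * ((2 * p + 1) * ((4 * p + 2) ^ p * bernExp q fun S => (bernVar q A S ^ (p + 1)).trace)) := by
    ring
  rw [e5]
  linarith

/-- Moments of weighted sums of squared deviations. -/
theorem bernExp_sum_sq_pow_le {q : κ → ℝ} {ρ : ℝ} (hρ : 0 < ρ) (h0 : ∀ k, ρ ≤ q k)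
    (h1 : ∀ k, q k ≤ 1) {δ : κ → ℝ} (hδ0 : ∀ k, 0 ≤ δ k) (hδ1 : ∀ k, δ k ≤ 1) {Λ s : ℝ}
    (hΛ : ∑ k, δ k * ((1 - q k) / q k) ≤ Λ) (hs0 : 0 < s) (hs : s ≤ ρ ^ 2) {p : ℕ} (hp : p ≠ 0) :
    bernExp q (fun S => (∑ k, ((bernDev (q k) (S k) ^ 2 + (1 - q k) / q k) / 2) * δ k) ^ p) ≤
      (p / s) ^ p * Real.exp (3 / 2 * s * Λ) := by
  have hq : ∀ k, 0 < q k := fun k => hρ.trans_le (h0 k)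
  have hv : ∀ k, 0 ≤ (1 - q k) / q k := fun k => div_nonneg (sub_nonneg.2 (h1 k)) (hq k).le
  have hp0 : (0 : ℝ) < p := by positivity
  have step : ∀ S : κ → Bool,
      (∑ k, ((bernDev (q k) (S k) ^ 2 + (1 - q k) / q k) / 2) * δ k) ^ p ≤
      (p / s) ^ p * ∏ k, Real.exp (s * (((bernDev (q k) (S k) ^ 2 + (1 - q k) / q k) / 2) * δ k)) := by
    intro S
    rw [← Real.exp_sum, ← Finset.mul_sum]
    set V := ∑ k, ((bernDev (q k) (S k) ^ 2 + (1 - q k) / q k) / 2) * δ k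
    have hV : 0 ≤ V := Finset.sum_nonneg fun k _ =>
      mul_nonneg (div_nonneg (add_nonneg (sq_nonneg _) (hv k)) zero_le_two) (hδ0 k)
    -- Raising y ≤ exp y, at y = sV/p, to the p-th power trades the moment for an exponential
    -- moment, which factorises over coordinates.
    have h3 : s * V / p ≤ Real.exp (s * V / p) := by
      linarith [Real.add_one_le_exp (s * V / p)]
    have h4 := pow_le_pow_left₀ (by positivity) h3 p
    rw [← Real.exp_nat_mul, mul_div_cancel₀ _ hp0.ne'] at h4
    calc V ^ p = (p / s) ^ p * (s * V / p) ^ p := by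
          rw [← mul_pow]
          congr 1
          field_simp
      _ ≤ _ := mul_le_mul_of_nonneg_left h4 (by positivity)
  refine (bernExp_mono (fun k => (hq k).le) h1 step).trans ?_
  rw [bernExp_const_mul]
  refine mul_le_mul_of_nonneg_left ?_ (by positivity)
  rw [bernExp_prod q fun k b =>
    Real.exp (s * (((bernDev (q k) b ^ 2 + (1 - q k) / q k) / 2) * δ k))]
  have hfac : ∀ k, q k * Real.exp (s * (((bernDev (q k) true ^ 2 + (1 - q k) / q k) / 2) * δ k)) +
      (1 - q k) * Real.exp (s * (((bernDev (q k) false ^ 2 + (1 - q k) / q k) / 2) * δ k)) ≤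
      Real.exp (3 / 2 * s * (δ k * ((1 - q k) / q k))) := by
    intro k
    set v := (1 - q k) / q k with hvdef
    set y := s / 2 * δ k with hy
    have hy0 : 0 ≤ y := mul_nonneg (by positivity) (hδ0 k)
    have hyρ : y ≤ ρ ^ 2 := by
      have : s / 2 * δ k ≤ s / 2 * 1 := mul_le_mul_of_nonneg_left (hδ1 k) (by positivity)
      linarith
    have hyq : y ≤ q k ^ 2 := hyρ.trans (pow_le_pow_left₀ hρ.le (h0 k) 2)
    -- The condition s ≤ ρ² keeps the random exponents y v² and y in [0, 1], where exp is below this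
    -- line. The linear terms then average to 2yv, because v is the variance of `bernDev`.
    have hexp : ∀ x : ℝ, 0 ≤ x → x ≤ 1 → Real.exp x ≤ 1 + 2 * x := by
      intro x hx0 hx1
      have := Real.abs_exp_sub_one_sub_id_le (x := x) (by rwa [abs_of_nonneg hx0])
      have := (abs_le.1 this).2
      nlinarith
    have hqk := hq k
    have hv2 : q k * v = 1 - q k := by rw [hvdef]; field_simp
    have d1 : bernDev (q k) true = v := by
      simp only [bernDev, if_true, hvdef]
      field_simp
    have d2 : bernDev (q k) false ^ 2 = 1 := by simp [bernDev]
    have b1 : y * v ^ 2 ≤ 1 := by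
      have : y * v ^ 2 ≤ q k ^ 2 * v ^ 2 := mul_le_mul_of_nonneg_right hyq (sq_nonneg _)
      rw [← mul_pow, hv2] at this
      nlinarith [h1 k]
    have b2 : y ≤ 1 := by nlinarith [h1 k]
    rw [d1, d2]
    have e1 : Real.exp (s * ((v ^ 2 + v) / 2 * δ k)) = Real.exp (y * v ^ 2) * Real.exp (y * v) := by
      rw [← Real.exp_add]
      congr 1
      rw [hy]
      ring
    have e2 : Real.exp (s * ((1 + v) / 2 * δ k)) = Real.exp y * Real.exp (y * v) := by
      rw [← Real.exp_add]
      congr 1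
      rw [hy]
      ring
    have e3 : Real.exp (3 / 2 * s * (δ k * v)) = Real.exp (2 * (y * v)) * Real.exp (y * v) := by
      rw [← Real.exp_add]
      congr 1
      rw [hy]
      ring
    rw [e1, e2, e3]
    have hv0 : 0 ≤ v := hv k
    have f1 := mul_le_mul_of_nonneg_left (hexp _ (mul_nonneg hy0 (sq_nonneg v)) b1) hqk.le
    have f2 := mul_le_mul_of_nonneg_left (hexp _ hy0 b2) (sub_nonneg.2 (h1 k))
    have f3 := Real.add_one_le_exp (2 * (y * v))
    have f4 : q k * (1 + 2 * (y * v ^ 2)) + (1 - q k) * (1 + 2 * y) = 2 * (y * v) + 1 := by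
      have : q k * (1 + 2 * (y * v ^ 2)) = q k + 2 * y * v * (q k * v) := by ring
      rw [this, hv2]
      have : 2 * y * v * (1 - q k) = 2 * y * v - 2 * y * (q k * v) := by ring
      rw [this, hv2]
      ring
    have := mul_le_mul_of_nonneg_right ((add_le_add f1 f2).trans (f4.le.trans f3))
      (Real.exp_pos (y * v)).le
    linarith
  calc _ ≤ ∏ k, Real.exp (3 / 2 * s * (δ k * ((1 - q k) / q k))) := by
        refine Finset.prod_le_prod (fun k _ => ?_) fun k _ => hfac k
        exact add_nonneg (mul_nonneg (hq k).le (Real.exp_pos _).le)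
          (mul_nonneg (sub_nonneg.2 (h1 k)) (Real.exp_pos _).le)
    _ = Real.exp (3 / 2 * s * ∑ k, δ k * ((1 - q k) / q k)) := by
        rw [← Real.exp_sum, Finset.mul_sum]
    _ ≤ _ := Real.exp_le_exp.2 (mul_le_mul_of_nonneg_left hΛ (by positivity))

end Bernoulli

/-! ### The spectral norm through quadratic forms. -/

section OpNorm

variable {m n : ℕ}

theorem toEuclideanLin_norm_sq (M : Matrix (Fin m) (Fin n) ℝ) (z : EuclideanSpace ℝ (Fin n)) :
    ‖Matrix.toEuclideanLin M z‖ ^ 2 = (M *ᵥ z.ofLp) ⬝ᵥ (M *ᵥ z.ofLp) := by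
  rw [EuclideanSpace.real_norm_sq_eq]
  simp [dotProduct, sq, Matrix.toLpLin_apply]

theorem opNorm_nonneg (M : Matrix (Fin m) (Fin n) ℝ) : 0 ≤ opNorm M := norm_nonneg _

theorem opNorm_le_of_sq_le {M : Matrix (Fin m) (Fin n) ℝ} {x : ℝ} (hx : 0 ≤ x)
    (h : ∀ z : Fin n → ℝ, (M *ᵥ z) ⬝ᵥ (M *ᵥ z) ≤ x ^ 2 * (z ⬝ᵥ z)) : opNorm M ≤ x := by
  refine ContinuousLinearMap.opNorm_le_bound _ hx fun z => ?_
  refine le_of_sq_le_sq ?_ (by positivity)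
  have e : ‖z‖ ^ 2 = z.ofLp ⬝ᵥ z.ofLp := by
    rw [EuclideanSpace.real_norm_sq_eq]
    simp [dotProduct, sq]
  rw [mul_pow, e]
  exact (toEuclideanLin_norm_sq M z).le.trans (h z.ofLp)

end OpNorm

/-! ### Hermitian dilation and the logarithmic bound on the deviation. -/

section Dilation

variable {m n : ℕ}

/-- The Hermitian dilation of a matrix unit. -/
noncomputable def dilationUnit (k : Fin m × Fin n) : Matrix (Fin m ⊕ Fin n) (Fin m ⊕ Fin n) ℝ :=
  Matrix.fromBlocks 0 (Matrix.single k.1 k.2 1) (Matrix.single k.2 k.1 1) 0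

theorem dilationUnit_isHermitian (k : Fin m × Fin n) : (dilationUnit k).IsHermitian := by
  rw [Matrix.IsHermitian, dilationUnit, Matrix.fromBlocks_conjTranspose]
  simp

/-- The indicator of the row and of the column of an entry. -/
def dilationIndicator (k : Fin m × Fin n) : Fin m ⊕ Fin n → ℝ :=
  Sum.elim (fun i => if k.1 = i then 1 else 0) (fun j => if k.2 = j then 1 else 0)

/-- Diagonal squares make `bernVar` diagonal, with row and column sums as entries, so its trace
moments reduce to scalar ones. -/
theorem dilationUnit_sq (k : Fin m × Fin n) :
    dilationUnit k ^ 2 = Matrix.diagonal (dilationIndicator k) := by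
  rw [sq, dilationUnit, Matrix.fromBlocks_multiply, dilationIndicator, ← Matrix.fromBlocks_diagonal]
  congr 1
  · rw [Matrix.single_mul_single_same, zero_mul, zero_add]
    ext i j
    simp only [Matrix.single, Matrix.diagonal_apply, Matrix.of_apply]
    grind
  · simp
  · simp
  · rw [Matrix.single_mul_single_same, zero_mul, add_zero]
    ext i j
    simp only [Matrix.single, Matrix.diagonal_apply, Matrix.of_apply]
    grind

theorem bernSeries_dilationUnit (q : Fin m × Fin n → ℝ) (S : Fin m × Fin n → Bool) :
    bernSeries q dilationUnit S = Matrix.fromBlocks 0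
      (Matrix.of fun i j => bernDev (q (i, j)) (S (i, j)))
      (Matrix.of fun i j => bernDev (q (i, j)) (S (i, j)))ᵀ 0 := by
  ext a b
  rw [bernSeries, Matrix.sum_apply]
  simp only [Matrix.smul_apply, dilationUnit]
  rcases a with a | a <;> rcases b with b | b
  · simp
  · simp [Matrix.single, Fintype.sum_prod_type, ite_and]
  · simp [Matrix.single, Fintype.sum_prod_type, ite_and]
  · simp

theorem bernVar_dilationUnit_pow_trace (q : Fin m × Fin n → ℝ) (S : Fin m × Fin n → Bool)
    (p : ℕ) : (bernVar q dilationUnit S ^ p).trace = ∑ a, (∑ k,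
      ((bernDev (q k) (S k) ^ 2 + (1 - q k) / q k) / 2) * dilationIndicator k a) ^ p := by
  have e : bernVar q dilationUnit S = Matrix.diagonal fun a =>
      ∑ k, ((bernDev (q k) (S k) ^ 2 + (1 - q k) / q k) / 2) * dilationIndicator k a := by
    ext a b
    rw [bernVar, Matrix.sum_apply]
    simp only [dilationUnit_sq, Matrix.smul_apply, Matrix.diagonal_apply]
    by_cases h : a = b <;> simp [h]
  rw [e, Matrix.diagonal_pow, Matrix.trace_diagonal]
  rfl

theorem sum_mul_dilationIndicator_le {v : Fin m × Fin n → ℝ} {c : ℝ} (hc : 0 ≤ c)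
    (hv : ∀ k, v k ≤ c) (a : Fin m ⊕ Fin n) :
    ∑ k, dilationIndicator k a * v k ≤ c * max (m : ℝ) n := by
  rw [Fintype.sum_prod_type]
  rcases a with a | a
  · simp only [dilationIndicator, Sum.elim_inl, ite_mul, one_mul, zero_mul]
    rw [Finset.sum_comm]
    simp only [Finset.sum_ite_eq', Finset.mem_univ, if_true]
    calc ∑ j, v (a, j) ≤ ∑ _j : Fin n, c := Finset.sum_le_sum fun j _ => hv _
      _ = c * n := by simp [mul_comm]
      _ ≤ _ := mul_le_mul_of_nonneg_left (le_max_right _ _) hc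
  · simp only [dilationIndicator, Sum.elim_inr, ite_mul, one_mul, zero_mul]
    simp only [Finset.sum_ite_eq', Finset.mem_univ, if_true]
    calc ∑ i, v (i, a) ≤ ∑ _i : Fin m, c := Finset.sum_le_sum fun j _ => hv _
      _ = c * m := by simp [mul_comm]
      _ ≤ _ := mul_le_mul_of_nonneg_left (le_max_left _ _) hc

/-- The deviation of the inversely weighted Bernoulli pattern from the all-ones matrix. -/
noncomputable def devMatrix (q : Fin m × Fin n → ℝ) (S : Fin m × Fin n → Bool) :
    Matrix (Fin m) (Fin n) ℝ :=
  Matrix.of fun i j => bernDev (q (i, j)) (S (i, j))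

/-- The dilation maps (0, z) to (Mz, 0), so bounding it on such vectors bounds M. -/
theorem opNorm_devMatrix_le {q : Fin m × Fin n → ℝ} {S : Fin m × Fin n → Bool} {p : ℕ}
    (hp : p ≠ 0) {t : ℝ} (ht : 0 ≤ t)
    (h : (bernSeries q dilationUnit S ^ (2 * p)).trace ≤ t ^ p) :
    opNorm (devMatrix q S) ≤ Real.sqrt t := by
  refine opNorm_le_of_sq_le (Real.sqrt_nonneg _) fun z => ?_
  rw [Real.sq_sqrt ht]
  have := dotProduct_mulVec_sq_le (bernSeries_isHermitian q dilationUnit_isHermitian S) hp ht h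
    (Sum.elim 0 z)
  rw [bernSeries_dilationUnit, Matrix.fromBlocks_mulVec] at this
  simpa [devMatrix] using this

theorem one_div_add_le_of_log_le {d : ℝ} (hd : 0 < d) {p : ℕ} (h : Real.log d ≤ p) :
    d * Real.exp (-2 * p) ≤ 1 / d := by
  have h1 : Real.exp (-2 * p) ≤ Real.exp (-2 * Real.log d) := Real.exp_le_exp.2 (by linarith)
  have h2 : Real.exp (-2 * Real.log d) = 1 / d ^ 2 := by
    rw [show -2 * Real.log d = -(Real.log d + Real.log d) by ring, Real.exp_neg, Real.exp_add,
      Real.exp_log hd, one_div, sq]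
  rw [h2] at h1
  calc d * Real.exp (-2 * p) ≤ d * (1 / d ^ 2) := mul_le_mul_of_nonneg_left h1 hd.le
    _ = 1 / d := by field_simp

theorem ceil_log_le {d : ℝ} (hd : 2 ≤ d) : (⌈Real.log d⌉₊ : ℝ) ≤ 3 * Real.log d := by
  have h1 : Real.log 2 ≤ Real.log d := Real.log_le_log two_pos hd
  have h2 := Real.log_two_gt_d9
  have h3 := Nat.ceil_lt_add_one (by linarith : 0 ≤ Real.log d)
  linarith

/-- Spectral norm of the deviation in the regime where the rows and columns are observed at least
logarithmically often. -/
theorem bernExp_opNorm_devMatrix_moment (hm : 0 < m) (hn : 0 < n) {q : Fin m × Fin n → ℝ} {ρ : ℝ}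
    (hρ : 0 < ρ) (h0 : ∀ k, ρ ≤ q k) (h1 : ∀ k, q k ≤ 1)
    (hlog : Real.log ((m : ℝ) + n) ≤ ρ * min (m : ℝ) n) :
    bernExp q (fun S => if 25 * Real.sqrt (Real.log ((m : ℝ) + n) * max (m : ℝ) n / ρ) <
      opNorm (devMatrix q S) then 1 else 0) ≤ 1 / ((m : ℝ) + n) := by
  have hm1 : (1 : ℝ) ≤ m := by exact_mod_cast hm
  have hn1 : (1 : ℝ) ≤ n := by exact_mod_cast hn
  have hq : ∀ k, 0 < q k := fun k => hρ.trans_le (h0 k)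
  set d : ℝ := (m : ℝ) + n
  have hd : 2 ≤ d := by simp only [d]; linarith
  set x : ℝ := max (m : ℝ) n
  have hx : 1 ≤ x := hm1.trans (le_max_left _ _)
  have hlogpos : 0 < Real.log d := Real.log_pos (by linarith)
  set p := ⌈Real.log d⌉₊ with hpdef
  have hp0 : p ≠ 0 := (Nat.ceil_pos.2 hlogpos).ne'
  have hple : (p : ℝ) ≤ 3 * Real.log d := ceil_log_le hd
  have hpge : Real.log d ≤ p := Nat.le_ceil _
  have hppos : (0 : ℝ) < p := hlogpos.trans_le hpge
  -- This makes exp((3/2) s x/ρ) equal to exp(p/2), harmless after a p-th root. The condition s ≤ ρ²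
  -- amounts to p ≤ 3ρx, which follows from p ≤ 3 log d and `hlog`.
  set s : ℝ := p * ρ / (3 * x) with hs
  have hspos : 0 < s := by positivity
  have hsle : s ≤ ρ ^ 2 := by
    rw [hs, div_le_iff₀ (by positivity)]
    have : min (m : ℝ) n ≤ x := min_le_left _ _ |>.trans (le_max_left _ _)
    have h3 : ρ * min (m : ℝ) n ≤ ρ * x := mul_le_mul_of_nonneg_left this hρ.le
    have h4 : (p : ℝ) ≤ 3 * (ρ * x) := by linarith
    nlinarith
  -- moments of the variance proxy
  have hvar : bernExp q (fun S => (bernVar q dilationUnit S ^ p).trace) ≤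
      d * ((p / s) ^ p * Real.exp (3 / 2 * s * (ρ⁻¹ * x))) := by
    simp only [bernVar_dilationUnit_pow_trace, bernExp_sum]
    refine (Finset.sum_le_card_nsmul _ _ _ fun a _ => bernExp_sum_sq_pow_le hρ h0 h1
      (δ := fun k => dilationIndicator k a) (Λ := ρ⁻¹ * x)
      (fun k => ?_) (fun k => ?_) ?_ hspos hsle hp0).trans ?_
    · rcases a with a | a <;> simp only [dilationIndicator, Sum.elim_inl, Sum.elim_inr] <;>
        split_ifs <;> norm_num
    · rcases a with a | a <;> simp only [dilationIndicator, Sum.elim_inl, Sum.elim_inr] <;>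
        split_ifs <;> norm_num
    · refine sum_mul_dilationIndicator_le (inv_nonneg.2 hρ.le) (fun k => ?_) a
      rw [div_le_iff₀ (hq k), inv_mul_eq_div, le_div_iff₀ hρ]
      nlinarith [h0 k, h1 k]
    · simp [d]
  -- The factor exp 2 is the Markov margin: it leaves d exp(−2p), at most 1/d because p ≥ log d.
  set t : ℝ := Real.exp 2 * (4 * p * (p / s) * Real.exp (1 / 2)) with ht
  have htpos : 0 < t := by positivity
  have htr : bernExp q (fun S => (bernSeries q dilationUnit S ^ (2 * p)).trace) ≤
      d * Real.exp (-2 * p) * t ^ p := by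
    obtain ⟨p', hp'⟩ := Nat.exists_eq_succ_of_ne_zero hp0
    have h2 := bernExp_trace_pow_le_trace_bernVar hq h1 (A := dilationUnit)
      dilationUnit_isHermitian p'
    rw [← Nat.succ_eq_add_one, ← hp'] at h2
    refine h2.trans ?_
    have h3 : (4 * (p' : ℝ) + 2) ^ p ≤ (4 * p) ^ p := by
      refine pow_le_pow_left₀ (by positivity) ?_ _
      rw [hp']
      push_cast
      linarith
    have hnn : 0 ≤ bernExp q (fun S => (bernVar q dilationUnit S ^ p).trace) := by
      rw [← bernExp_const q 0]
      refine bernExp_mono (fun k => (hq k).le) h1 fun S => ?_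
      rw [bernVar_dilationUnit_pow_trace]
      refine Finset.sum_nonneg fun a _ => pow_nonneg (Finset.sum_nonneg fun k _ => ?_) _
      refine mul_nonneg ?_ ?_
      · have := div_nonneg (sub_nonneg.2 (h1 k)) (hq k).le
        positivity
      · rcases a with a | a <;> simp only [dilationIndicator, Sum.elim_inl, Sum.elim_inr] <;>
          split_ifs <;> norm_num
    refine (mul_le_mul h3 hvar hnn (by positivity)).trans (le_of_eq ?_)
    have e1 : 3 / 2 * s * (ρ⁻¹ * x) = p * (1 / 2) := by
      rw [hs]
      field_simp
    rw [e1, ht, mul_pow (Real.exp 2), ← Real.exp_nat_mul,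
      show d * Real.exp (-2 * p) * (Real.exp (p * 2) * (4 * p * (p / s) * Real.exp (1 / 2)) ^ p) =
        (Real.exp (-2 * p) * Real.exp (p * 2)) * (d * (4 * p * (p / s) * Real.exp (1 / 2)) ^ p) by
        ring, ← Real.exp_add, show -2 * (p : ℝ) + p * 2 = 0 by ring, Real.exp_zero, one_mul,
      mul_pow, mul_pow _ (Real.exp (1 / 2)), ← Real.exp_nat_mul]
    ring_nf
  -- Markov's inequality
  have hbound : t ≤ 25 ^ 2 * (Real.log d * x / ρ) := by
    have e : t = Real.exp (5 / 2) * 12 * p * (x / ρ) := by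
      rw [ht, hs, show (5 : ℝ) / 2 = 2 + 1 / 2 by norm_num, Real.exp_add]
      field_simp
      ring
    have he : Real.exp (5 / 2) ≤ 17 := by
      have h5 : Real.exp (5 / 2) ^ 2 = Real.exp 1 ^ 5 := by
        rw [← Real.exp_nat_mul, ← Real.exp_nat_mul]
        norm_num
      have h6 : Real.exp 1 ^ 5 ≤ 2.7182818286 ^ 5 :=
        pow_le_pow_left₀ (Real.exp_pos 1).le Real.exp_one_lt_d9.le 5
      refine le_of_sq_le_sq ?_ (by norm_num)
      rw [h5]
      refine h6.trans (by norm_num)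
    rw [e]
    -- Origin of the constant 25: 17 · 12 · 3 = 612 ≤ 25².
    have h7 : Real.exp (5 / 2) * 12 * p ≤ 17 * 12 * (3 * Real.log d) := by gcongr
    have h8 : 0 < x / ρ := by positivity
    have h9 := mul_le_mul_of_nonneg_right h7 h8.le
    have h10 : 0 < Real.log d * (x / ρ) := by positivity
    rw [mul_div_assoc]
    nlinarith
  have hind : ∀ S, (if 25 * Real.sqrt (Real.log d * x / ρ) < opNorm (devMatrix q S) then
      (1 : ℝ) else 0) ≤ (t ^ p)⁻¹ * (bernSeries q dilationUnit S ^ (2 * p)).trace := by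
    intro S
    have hnn : 0 ≤ (bernSeries q dilationUnit S ^ (2 * p)).trace := by
      have hH : ((bernSeries q dilationUnit S) ^ p).IsHermitian :=
        (bernSeries_isHermitian q dilationUnit_isHermitian S).pow p
      have := (Matrix.posSemidef_conjTranspose_mul_self (bernSeries q dilationUnit S ^ p)).trace_nonneg
      rwa [hH.eq, ← sq, ← pow_mul, mul_comm p 2] at this
    split_ifs with hlt
    · by_contra hcon
      rw [not_le, inv_mul_lt_iff₀ (by positivity), mul_one] at hcon
      have h5 := opNorm_devMatrix_le hp0 htpos.le hcon.le
      have h6 : Real.sqrt t ≤ 25 * Real.sqrt (Real.log d * x / ρ) := by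
        rw [Real.sqrt_le_left (by positivity), mul_pow, Real.sq_sqrt (by positivity)]
        exact hbound
      linarith
    · positivity
  refine (bernExp_mono (fun k => (hq k).le) h1 hind).trans ?_
  rw [bernExp_const_mul]
  calc _ ≤ (t ^ p)⁻¹ * (d * Real.exp (-2 * p) * t ^ p) :=
        mul_le_mul_of_nonneg_left htr (by positivity)
    _ = d * Real.exp (-2 * p) := by field_simp
    _ ≤ 1 / d := one_div_add_le_of_log_le (by linarith) hpge

end Dilation

/-! ### Chernoff bounds for Bernoulli sums. -/

section Tails

variable {κ : Type*} [Fintype κ] [DecidableEq κ]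

/-- Used on centred variables: the linear term vanishes in expectation, leaving an exponential
square moment. -/
theorem exp_le_add_exp_sq (x : ℝ) : Real.exp x ≤ x + Real.exp (x ^ 2) := by
  rcases le_total |x| 1 with h | h
  · have h1 := (abs_le.1 (Real.abs_exp_sub_one_sub_id_le h)).2
    have h2 := Real.add_one_le_exp (x ^ 2)
    linarith
  · rcases le_abs'.1 h with h | h
    · have h1 : Real.exp x ≤ 1 := Real.exp_le_one_iff.2 (by linarith)
      have h2 := Real.add_one_le_exp (x ^ 2)
      nlinarith
    · have : Real.exp x ≤ Real.exp (x ^ 2) := Real.exp_le_exp.2 (by nlinarith)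
      linarith

theorem bernExp_tail_le {q : κ → ℝ} (h0 : ∀ k, 0 ≤ q k) (h1 : ∀ k, q k ≤ 1)
    {φ : κ → Bool → ℝ} {b : κ → ℝ}
    (h : ∀ k, q k * Real.exp (φ k true) + (1 - q k) * Real.exp (φ k false) ≤ Real.exp (b k))
    (x : ℝ) :
    bernExp q (fun S => if x < ∑ k, φ k (S k) then 1 else 0) ≤ Real.exp (∑ k, b k - x) := by
  have hind : ∀ S : κ → Bool, (if x < ∑ k, φ k (S k) then (1 : ℝ) else 0) ≤
      Real.exp (-x) * ∏ k, Real.exp (φ k (S k)) := by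
    intro S
    rw [← Real.exp_sum, ← Real.exp_add]
    split_ifs with hx
    · exact Real.one_le_exp (by linarith)
    · positivity
  refine (bernExp_mono h0 h1 hind).trans ?_
  rw [bernExp_const_mul, bernExp_prod q fun k b => Real.exp (φ k b),
    show ∑ k, b k - x = -x + ∑ k, b k by ring, Real.exp_add, Real.exp_sum]
  refine mul_le_mul_of_nonneg_left (Finset.prod_le_prod (fun k _ => ?_) fun k _ => h k)
    (Real.exp_pos _).le
  exact add_nonneg (mul_nonneg (h0 k) (Real.exp_pos _).le)
    (mul_nonneg (sub_nonneg.2 (h1 k)) (Real.exp_pos _).le)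

/-- A Hoeffding inequality for the centred and rescaled Bernoulli variables. -/
theorem bernExp_linear_tail_le {q : κ → ℝ} {ρ : ℝ} (hρ : 0 < ρ) (h0 : ∀ k, ρ ≤ q k)
    (h1 : ∀ k, q k ≤ 1) {c : κ → ℝ} {s x : ℝ} (hs : 0 < s) (hc : ∑ k, c k ^ 2 ≤ s)
    (hx : 0 < x) :
    bernExp q (fun S => if x < ∑ k, c k * bernDev (q k) (S k) then 1 else 0) ≤
      Real.exp (-(x ^ 2 * ρ ^ 2 / (4 * s))) := by
  have hq : ∀ k, 0 < q k := fun k => hρ.trans_le (h0 k)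
  -- The minimiser of l² s/ρ² − l x. Here 1/ρ² bounds the squared deviations.
  set l : ℝ := x * ρ ^ 2 / (2 * s)
  have hl : 0 < l := by positivity
  have hfac : ∀ k, q k * Real.exp (l * c k * bernDev (q k) true) +
      (1 - q k) * Real.exp (l * c k * bernDev (q k) false) ≤
      Real.exp (l ^ 2 / ρ ^ 2 * c k ^ 2) := by
    intro k
    have hqk := hq k
    have hρq : ρ ^ 2 ≤ q k ^ 2 := pow_le_pow_left₀ hρ.le (h0 k) 2
    have d1 : q k * bernDev (q k) true = 1 - q k := by
      simp only [bernDev, if_true]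
      field_simp
    have d2 : bernDev (q k) false = -1 := by simp [bernDev]
    have b1 : bernDev (q k) true ^ 2 ≤ 1 / ρ ^ 2 := by
      have h2 : (q k * bernDev (q k) true) ^ 2 ≤ 1 := by
        rw [d1]
        nlinarith [h1 k]
      rw [le_div_iff₀ (by positivity)]
      rw [mul_pow] at h2
      nlinarith [sq_nonneg (bernDev (q k) true)]
    have b2 : bernDev (q k) false ^ 2 ≤ 1 / ρ ^ 2 := by
      rw [d2, le_div_iff₀ (by positivity)]
      nlinarith [h0 k, h1 k]
    have hexp : ∀ b, bernDev (q k) b ^ 2 ≤ 1 / ρ ^ 2 → Real.exp (l * c k * bernDev (q k) b) ≤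
        l * c k * bernDev (q k) b + Real.exp (l ^ 2 / ρ ^ 2 * c k ^ 2) := by
      intro b hb
      refine (exp_le_add_exp_sq _).trans (add_le_add_right (Real.exp_le_exp.2 ?_) _)
      have := mul_le_mul_of_nonneg_left hb (sq_nonneg (l * c k))
      calc (l * c k * bernDev (q k) b) ^ 2 = (l * c k) ^ 2 * bernDev (q k) b ^ 2 := by ring
        _ ≤ (l * c k) ^ 2 * (1 / ρ ^ 2) := this
        _ = _ := by ring
    have f1 := mul_le_mul_of_nonneg_left (hexp true b1) hqk.le
    have f2 := mul_le_mul_of_nonneg_left (hexp false b2) (sub_nonneg.2 (h1 k))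
    have f3 : q k * (l * c k * bernDev (q k) true) = l * c k * (1 - q k) := by
      rw [← d1]
      ring
    rw [mul_add, f3] at f1
    rw [mul_add, d2] at f2
    rw [d2]
    nlinarith
  have main := bernExp_tail_le (fun k => (hq k).le) h1
    (φ := fun k b => l * c k * bernDev (q k) b) hfac (l * x)
  have e : ∀ S : κ → Bool, (l * x < ∑ k, l * c k * bernDev (q k) (S k)) ↔
      x < ∑ k, c k * bernDev (q k) (S k) := by
    intro S
    simp only [mul_assoc, ← Finset.mul_sum]
    exact mul_lt_mul_iff_right₀ hl
  simp only [e] at main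
  refine main.trans (Real.exp_le_exp.2 ?_)
  rw [← Finset.mul_sum]
  have h3 : l ^ 2 / ρ ^ 2 * ∑ k, c k ^ 2 ≤ l ^ 2 / ρ ^ 2 * s :=
    mul_le_mul_of_nonneg_left hc (by positivity)
  have h4 : l ^ 2 / ρ ^ 2 * s - l * x = -(x ^ 2 * ρ ^ 2 / (4 * s)) := by
    simp only [l]
    field_simp
    ring
  linarith

/-- The inverse probability weights are feasible with high probability. -/
theorem bernExp_sum_inv_sq_tail_le {q : κ → ℝ} {ρ : ℝ} (hρ : 0 < ρ) (h0 : ∀ k, ρ ≤ q k)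
    (h1 : ∀ k, q k ≤ 1) :
    bernExp q (fun S => if 2 * ∑ k, (q k)⁻¹ < ∑ k, (if S k then ((q k)⁻¹) ^ 2 else 0) then 1 else 0) ≤
      Real.exp (-(Real.log 2 / 2 * ρ ^ 2 * ∑ k, (q k)⁻¹)) := by
  have hq : ∀ k, 0 < q k := fun k => hρ.trans_le (h0 k)
  have hlog : 0 < Real.log 2 := Real.log_pos one_lt_two
  -- This l turns the exponential into 2^θ with θ = ρ²/q² ≤ 1, and 2^θ ≤ 1 + θ. The exponent becomes
  -- (1 − 2 log 2) ρ² Σ 1/q, which suffices because (3/2) log 2 ≥ 1.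
  set l : ℝ := ρ ^ 2 * Real.log 2
  have hl : 0 < l := by positivity
  have hfac : ∀ k, q k * Real.exp (l * (if true then ((q k)⁻¹) ^ 2 else 0)) +
      (1 - q k) * Real.exp (l * (if false then ((q k)⁻¹) ^ 2 else 0)) ≤
      Real.exp (ρ ^ 2 * (q k)⁻¹) := by
    intro k
    have hqk := hq k
    have hθ : ρ ^ 2 * ((q k)⁻¹) ^ 2 ≤ 1 := by
      rw [inv_pow, ← div_eq_mul_inv, div_le_one (by positivity)]
      exact pow_le_pow_left₀ hρ.le (h0 k) 2
    have h2 := _root_.rpow_one_add_le_one_add_mul_self (s := 1) (by norm_num)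
      (by positivity : 0 ≤ ρ ^ 2 * ((q k)⁻¹) ^ 2) hθ
    rw [Real.rpow_def_of_pos (by norm_num)] at h2
    norm_num at h2
    simp only [if_true, Bool.false_eq_true, if_false, mul_zero, Real.exp_zero]
    have e : l * (q k)⁻¹ ^ 2 = Real.log 2 * (ρ ^ 2 * (q k ^ 2)⁻¹) := by
      simp only [l, inv_pow]
      ring
    rw [e]
    have h3 := mul_le_mul_of_nonneg_left h2 hqk.le
    have h4 := Real.add_one_le_exp (ρ ^ 2 * (q k)⁻¹)
    have h5 : q k * (1 + ρ ^ 2 * (q k ^ 2)⁻¹) = q k + ρ ^ 2 * (q k)⁻¹ := by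
      field_simp
    linarith
  have main := bernExp_tail_le (fun k => (hq k).le) h1
    (φ := fun k b => l * (if b then ((q k)⁻¹) ^ 2 else 0)) hfac (l * (2 * ∑ k, (q k)⁻¹))
  have e : ∀ S : κ → Bool, (l * (2 * ∑ k, (q k)⁻¹) <
      ∑ k, l * (if S k then ((q k)⁻¹) ^ 2 else 0)) ↔
      2 * ∑ k, (q k)⁻¹ < ∑ k, (if S k then ((q k)⁻¹) ^ 2 else 0) := by
    intro S
    rw [← Finset.mul_sum]
    exact mul_lt_mul_iff_right₀ hl
  simp only [e] at main
  refine main.trans (Real.exp_le_exp.2 ?_)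
  rw [← Finset.mul_sum]
  have hpos : 0 ≤ ρ ^ 2 * ∑ k, (q k)⁻¹ :=
    mul_nonneg (sq_nonneg _) (Finset.sum_nonneg fun k _ => (inv_pos.2 (hq k)).le)
  have := Real.log_two_gt_d9
  simp only [l]
  nlinarith

end Tails

/-! ### Covering arguments and the dimension bound on the deviation. -/

section Net

/-- A net of the ball of radius `2`. -/
theorem exists_net (n : ℕ) : ∃ s : Finset (EuclideanSpace ℝ (Fin n)), s.card ≤ 5 ^ n ∧
    (∀ c ∈ s, ‖c‖ ≤ 2) ∧ ∀ x : EuclideanSpace ℝ (Fin n), ‖x‖ ≤ 2 → ∃ c ∈ s, ‖x - c‖ ≤ 1 := by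
  classical
  let Q : ℕ → Prop := fun k => ∃ s : Finset (EuclideanSpace ℝ (Fin n)), s.card = k ∧
    (∀ c ∈ s, ‖c‖ ≤ 2) ∧ ∀ c ∈ s, ∀ d ∈ s, c ≠ d → 1 ≤ ‖c - d‖
  have hQ0 : Q 0 := ⟨∅, by simp⟩
  have hbd : ∀ s : Finset (EuclideanSpace ℝ (Fin n)), (∀ c ∈ s, ‖c‖ ≤ 2) →
      (∀ c ∈ s, ∀ d ∈ s, c ≠ d → 1 ≤ ‖c - d‖) → s.card ≤ 5 ^ n := by
    intro s h1 h2
    simpa using Besicovitch.card_le_of_separated s h1 h2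
  -- A 1-separated set of greatest cardinality is a net: a point farther than 1 from all of it could
  -- be added.
  obtain ⟨s, hcard, hs2, hsep⟩ := Nat.findGreatest_spec (P := Q) (Nat.zero_le (5 ^ n)) hQ0
  refine ⟨s, hbd s hs2 hsep, hs2, fun x hx => ?_⟩
  by_contra! hcon
  have hxs : x ∉ s := fun h => by
    have := hcon x h
    simp at this
    linarith
  have hle2 : ∀ c ∈ insert x s, ‖c‖ ≤ 2 := by
    intro c hc
    rcases Finset.mem_insert.1 hc with rfl | hc
    · exact hx
    · exact hs2 c hc
  have hsep2 : ∀ c ∈ insert x s, ∀ d ∈ insert x s, c ≠ d → 1 ≤ ‖c - d‖ := by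
    intro c hc d hd hcd
    rcases Finset.mem_insert.1 hc with rfl | hc' <;> rcases Finset.mem_insert.1 hd with rfl | hd'
    · exact absurd rfl hcd
    · exact (hcon d hd').le
    · rw [norm_sub_rev]
      exact (hcon c hc').le
    · exact hsep c hc' d hd' hcd
  have h3 : Q (s.card + 1) := ⟨insert x s, Finset.card_insert_of_notMem hxs, hle2, hsep2⟩
  have h4 : s.card + 1 ≤ 5 ^ n := by
    rw [← Finset.card_insert_of_notMem hxs]
    exact hbd _ hle2 hsep2
  have := Nat.le_findGreatest h4 h3
  omega

/-- Radius 2 with mesh 1 avoids any loss of constant: testing y against a net point near 2y/‖y‖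
gives 2‖y‖ ≤ b + ‖y‖. -/
theorem norm_le_of_net {E : Type*} [NormedAddCommGroup E] [InnerProductSpace ℝ E] {s : Finset E}
    (hs : ∀ x : E, ‖x‖ ≤ 2 → ∃ c ∈ s, ‖x - c‖ ≤ 1) {y : E} {b : ℝ} (hb : 0 ≤ b)
    (h : ∀ c ∈ s, inner ℝ c y ≤ b) : ‖y‖ ≤ b := by
  rcases eq_or_ne y 0 with rfl | hy
  · simpa using hb
  have hy' : 0 < ‖y‖ := norm_pos_iff.2 hy
  obtain ⟨c, hc, hxc⟩ := hs ((2 / ‖y‖) • y) (by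
    rw [norm_smul, Real.norm_of_nonneg (by positivity)]
    field_simp
    exact le_rfl)
  have h1 := h c hc
  have h2 : inner ℝ ((2 / ‖y‖) • y - c) y ≤ 1 * ‖y‖ :=
    (real_inner_le_norm _ _).trans (mul_le_mul_of_nonneg_right hxc hy'.le)
  rw [inner_sub_left, real_inner_smul_left, real_inner_self_eq_norm_sq] at h2
  have h3 : 2 / ‖y‖ * ‖y‖ ^ 2 = 2 * ‖y‖ := by field_simp
  linarith

/-- The same rescaling gives 2‖f y‖/‖y‖ ≤ b + ‖f‖, hence ‖f‖ ≤ (b + ‖f‖)/2, and ‖f‖ is absorbed. -/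
theorem opNorm_le_of_net {E F : Type*} [NormedAddCommGroup E] [InnerProductSpace ℝ E]
    [NormedAddCommGroup F] [InnerProductSpace ℝ F] {s : Finset E}
    (hs : ∀ x : E, ‖x‖ ≤ 2 → ∃ c ∈ s, ‖x - c‖ ≤ 1) (f : E →L[ℝ] F) {b : ℝ} (hb : 0 ≤ b)
    (h : ∀ c ∈ s, ‖f c‖ ≤ b) : ‖f‖ ≤ b := by
  have key : ‖f‖ ≤ (b + ‖f‖) / 2 := by
    refine ContinuousLinearMap.opNorm_le_bound _ (by positivity) fun y => ?_
    rcases eq_or_ne y 0 with rfl | hy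
    · simp
    have hy' : 0 < ‖y‖ := norm_pos_iff.2 hy
    obtain ⟨c, hc, hxc⟩ := hs ((2 / ‖y‖) • y) (by
      rw [norm_smul, Real.norm_of_nonneg (by positivity)]
      field_simp
      exact le_rfl)
    have h1 : ‖f ((2 / ‖y‖) • y)‖ ≤ b + ‖f‖ := by
      have h2 : f ((2 / ‖y‖) • y) = f c + f ((2 / ‖y‖) • y - c) := by
        rw [← map_add]
        congr 1
        abel
      rw [h2]
      refine (norm_add_le _ _).trans (add_le_add (h c hc) ((f.le_opNorm _).trans ?_))
      exact mul_le_of_le_one_right (norm_nonneg _) hxc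
    rw [map_smul, norm_smul, Real.norm_of_nonneg (by positivity)] at h1
    have h3 : 2 / ‖y‖ * ‖f y‖ = 2 * ‖f y‖ / ‖y‖ := by ring
    rw [h3, div_le_iff₀ hy'] at h1
    linarith
  linarith

variable {m n : ℕ}

theorem opNorm_le_of_nets {s : Finset (EuclideanSpace ℝ (Fin m))}
    (hs : ∀ x : EuclideanSpace ℝ (Fin m), ‖x‖ ≤ 2 → ∃ c ∈ s, ‖x - c‖ ≤ 1)
    {t : Finset (EuclideanSpace ℝ (Fin n))}
    (ht : ∀ x : EuclideanSpace ℝ (Fin n), ‖x‖ ≤ 2 → ∃ c ∈ t, ‖x - c‖ ≤ 1)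
    {M : Matrix (Fin m) (Fin n) ℝ} {b : ℝ} (hb : 0 ≤ b)
    (h : ∀ u ∈ s, ∀ v ∈ t, ∑ k : Fin m × Fin n, u k.1 * v k.2 * M k.1 k.2 ≤ b) :
    opNorm M ≤ b := by
  refine opNorm_le_of_net ht _ hb fun v hv => norm_le_of_net hs hb fun u hu => ?_
  refine le_trans (le_of_eq ?_) (h u hu v hv)
  rw [Fintype.sum_prod_type]
  simp only [LinearMap.coe_toContinuousLinearMap', PiLp.inner_apply, Matrix.toLpLin_apply,
    Matrix.mulVec, dotProduct, RCLike.inner_apply, conj_trivial, Finset.sum_mul]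
  exact Finset.sum_congr rfl fun i _ => Finset.sum_congr rfl fun j _ => by ring

/-- Spectral norm of the deviation, by a covering argument. -/
theorem bernExp_opNorm_devMatrix_net (hm : 0 < m) {q : Fin m × Fin n → ℝ} {ρ : ℝ}
    (hρ : 0 < ρ) (h0 : ∀ k, ρ ≤ q k) (h1 : ∀ k, q k ≤ 1) :
    bernExp q (fun S => if 14 * (Real.sqrt ((m : ℝ) + n) / ρ) <
      opNorm (devMatrix q S) then 1 else 0) ≤ 1 / ((m : ℝ) + n) := by
  have hq : ∀ k, 0 < q k := fun k => hρ.trans_le (h0 k)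
  obtain ⟨s, hscard, hs2, hs⟩ := exists_net m
  obtain ⟨t, htcard, ht2, ht⟩ := exists_net n
  set d : ℝ := (m : ℝ) + n with hd
  have hdpos : 0 < d := by positivity
  -- Net vectors have norm at most 2, so the coefficients have square sum at most 16. The Hoeffding
  -- exponent is 196d/64 ≥ 3d, against at most 5^(m+n) ≤ exp(2d) pairs.
  set x : ℝ := 14 * (Real.sqrt d / ρ) with hx
  have hxpos : 0 < x := by positivity
  have hind : ∀ S, (if x < opNorm (devMatrix q S) then (1 : ℝ) else 0) ≤
      ∑ u ∈ s, ∑ v ∈ t,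
        (if x < ∑ k : Fin m × Fin n, u.ofLp k.1 * v.ofLp k.2 * bernDev (q k) (S k) then 1 else 0) := by
    intro S
    split_ifs with hlt
    · have hex : ∃ u ∈ s, ∃ v ∈ t,
          x < ∑ k : Fin m × Fin n, u k.1 * v k.2 * bernDev (q k) (S k) := by
        by_contra! hcon
        exact absurd (opNorm_le_of_nets hs ht hxpos.le hcon) (not_le.2 hlt)
      obtain ⟨u, hu, v, hv, huv⟩ := hex
      have hnn : ∀ (u : Fin m → ℝ) (v : Fin n → ℝ), (0 : ℝ) ≤
          (if x < ∑ k : Fin m × Fin n, u k.1 * v k.2 * bernDev (q k) (S k) then 1 else 0) := by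
        intro u v
        split_ifs <;> norm_num
      calc (1 : ℝ) = (if x < ∑ k : Fin m × Fin n, u k.1 * v k.2 * bernDev (q k) (S k) then 1
            else 0) := by rw [if_pos huv]
        _ ≤ ∑ v ∈ t, (if x < ∑ k : Fin m × Fin n, u k.1 * v k.2 * bernDev (q k) (S k) then 1
            else 0) := Finset.single_le_sum (f := fun v : EuclideanSpace ℝ (Fin n) =>
              (if x < ∑ k : Fin m × Fin n, u k.1 * v k.2 * bernDev (q k) (S k) then (1 : ℝ)
                else 0)) (fun v _ => hnn u.ofLp v.ofLp) hv
        _ ≤ _ := Finset.single_le_sum (f := fun u : EuclideanSpace ℝ (Fin m) => ∑ v ∈ t,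
              (if x < ∑ k : Fin m × Fin n, u k.1 * v k.2 * bernDev (q k) (S k) then (1 : ℝ)
                else 0)) (fun u _ => Finset.sum_nonneg fun v _ => hnn u.ofLp v.ofLp) hu
    · refine Finset.sum_nonneg fun u _ => Finset.sum_nonneg fun v _ => ?_
      split_ifs <;> norm_num
  refine (bernExp_mono (fun k => (hq k).le) h1 hind).trans ?_
  simp only [bernExp_sum]
  have hterm : ∀ u ∈ s, ∀ v ∈ t, bernExp q (fun S =>
      if x < ∑ k : Fin m × Fin n, u k.1 * v k.2 * bernDev (q k) (S k) then 1 else 0) ≤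
      Real.exp (-(3 * d)) := by
    intro u hu v hv
    have hsum : ∑ k : Fin m × Fin n, (u k.1 * v k.2) ^ 2 ≤ 16 := by
      have e : ∑ k : Fin m × Fin n, (u k.1 * v k.2) ^ 2 = ‖u‖ ^ 2 * ‖v‖ ^ 2 := by
        rw [EuclideanSpace.real_norm_sq_eq, EuclideanSpace.real_norm_sq_eq,
          Fintype.sum_prod_type, Finset.sum_mul_sum]
        simp only [mul_pow]
      rw [e]
      have a1 := pow_le_pow_left₀ (norm_nonneg _) (hs2 u hu) 2
      have a2 := pow_le_pow_left₀ (norm_nonneg _) (ht2 v hv) 2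
      nlinarith [sq_nonneg ‖u‖, sq_nonneg ‖v‖]
    refine (bernExp_linear_tail_le hρ h0 h1 (by norm_num : (0 : ℝ) < 16) hsum hxpos).trans
      (Real.exp_le_exp.2 ?_)
    have e : x ^ 2 * ρ ^ 2 = 196 * d := by
      rw [hx, mul_pow, div_pow, Real.sq_sqrt hdpos.le]
      field_simp
      norm_num
    rw [e]
    linarith
  calc _ ≤ ∑ u ∈ s, ∑ v ∈ t, Real.exp (-(3 * d)) :=
        Finset.sum_le_sum fun u hu => Finset.sum_le_sum fun v hv => hterm u hu v hv
    _ = (s.card : ℝ) * (t.card * Real.exp (-(3 * d))) := by simp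
    _ ≤ 5 ^ m * (5 ^ n * Real.exp (-(3 * d))) := by
        gcongr
        · exact_mod_cast hscard
        · exact_mod_cast htcard
    _ ≤ Real.exp (2 * d) * Real.exp (-(3 * d)) := by
        have h5 : (5 : ℝ) ≤ Real.exp 2 := by
          have := Real.exp_one_gt_d9
          rw [show (2 : ℝ) = 1 + 1 by norm_num, Real.exp_add]
          nlinarith
        have h6 : (5 : ℝ) ^ (m + n) ≤ Real.exp (2 * d) := by
          rw [hd, mul_comm]
          have := pow_le_pow_left₀ (by norm_num) h5 (m + n)
          rwa [← Real.exp_nat_mul, Nat.cast_add] at this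
        rw [← mul_assoc, ← pow_add]
        gcongr
    _ = Real.exp (-d) := by
        rw [← Real.exp_add]
        ring_nf
    _ ≤ 1 / d := by
        rw [Real.exp_neg, one_div]
        exact inv_anti₀ hdpos (by linarith [Real.add_one_le_exp d])

end Net

/-! ### Duality between the max norm and the spectral norm. -/

section MaxNorm

variable {m n : ℕ}

theorem twoInftyNorm_nonneg {k : ℕ} (U : Matrix (Fin m) (Fin k) ℝ) : 0 ≤ twoInftyNorm U :=
  Real.iSup_nonneg fun _ => Real.sqrt_nonneg _

theorem sum_sq_le_twoInftyNorm_sq {k : ℕ} (U : Matrix (Fin m) (Fin k) ℝ) (i : Fin m) :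
    ∑ l, U i l ^ 2 ≤ twoInftyNorm U ^ 2 := by
  have h : Real.sqrt (∑ l, U i l ^ 2) ≤ twoInftyNorm U :=
    le_ciSup (f := fun i => Real.sqrt (∑ l, U i l ^ 2)) (Set.finite_range _).bddAbove i
  exact (Real.sqrt_le_left (twoInftyNorm_nonneg U)).1 h

theorem maxNorm_nonneg (A : Matrix (Fin m) (Fin n) ℝ) : 0 ≤ maxNorm A := by
  refine Real.sInf_nonneg ?_
  rintro _ ⟨k, U, V, -, rfl⟩
  exact mul_nonneg (twoInftyNorm_nonneg U) (twoInftyNorm_nonneg V)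

/-- To bound a quantity by the max norm it is enough to bound it for every factorization. -/
theorem le_mul_of_maxNorm_le {A : Matrix (Fin m) (Fin n) ℝ} {β c y : ℝ} (hA : maxNorm A ≤ β)
    (hc : 0 ≤ c) (h : ∀ (k : ℕ) (U : Matrix (Fin m) (Fin k) ℝ) (V : Matrix (Fin n) (Fin k) ℝ),
      A = U * Vᵀ → y ≤ c * (twoInftyNorm U * twoInftyNorm V)) : y ≤ c * β := by
  refine le_trans ?_ (mul_le_mul_of_nonneg_left hA hc)
  refine le_of_forall_pos_le_add fun η hη => ?_
  have hne : {r : ℝ | ∃ (k : ℕ) (U : Matrix (Fin m) (Fin k) ℝ) (V : Matrix (Fin n) (Fin k) ℝ),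
      A = U * Vᵀ ∧ r = twoInftyNorm U * twoInftyNorm V}.Nonempty :=
    ⟨_, n, A, 1, by simp, rfl⟩
  -- The infimum need not be attained. The slack η/(c + 1), rather than η/c, also covers c = 0.
  obtain ⟨_, ⟨k, U, V, hUV, rfl⟩, hlt⟩ := exists_lt_of_csInf_lt hne
    (show sInf _ < maxNorm A + η / (c + 1) from lt_add_of_pos_right _ (by positivity))
  have h1 := h k U V hUV
  have h2 := mul_le_mul_of_nonneg_left hlt.le hc
  have h3 : c * (η / (c + 1)) ≤ η := by
    rw [← mul_div_assoc, div_le_iff₀ (by positivity)]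
    nlinarith
  linarith

theorem mul_transpose_apply {k : ℕ} (U : Matrix (Fin m) (Fin k) ℝ) (V : Matrix (Fin n) (Fin k) ℝ)
    (i : Fin m) (j : Fin n) : (U * Vᵀ) i j = ∑ l, U i l * V j l := by
  rw [Matrix.mul_apply]
  rfl

theorem abs_apply_le_of_maxNorm_le {A : Matrix (Fin m) (Fin n) ℝ} {β : ℝ} (hA : maxNorm A ≤ β)
    (i : Fin m) (j : Fin n) : |A i j| ≤ β := by
  rw [← one_mul β]
  refine le_mul_of_maxNorm_le hA zero_le_one fun k U V hUV => ?_
  rw [one_mul, hUV, mul_transpose_apply]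
  refine abs_le_of_sq_le_sq ?_ (mul_nonneg (twoInftyNorm_nonneg U) (twoInftyNorm_nonneg V))
  refine (Finset.sum_mul_sq_le_sq_mul_sq _ _ _).trans ?_
  rw [mul_pow]
  exact mul_le_mul (sum_sq_le_twoInftyNorm_sq U i) (sum_sq_le_twoInftyNorm_sq V j)
    (Finset.sum_nonneg fun _ _ => sq_nonneg _) (sq_nonneg _)

theorem bilin_le_opNorm (M : Matrix (Fin m) (Fin n) ℝ) (u : Fin m → ℝ) (v : Fin n → ℝ) :
    ∑ i, ∑ j, M i j * (u i * v j) ≤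
      opNorm M * (Real.sqrt (∑ i, u i ^ 2) * Real.sqrt (∑ j, v j ^ 2)) := by
  have h1 : ∑ i, ∑ j, M i j * (u i * v j) =
      inner ℝ (WithLp.toLp 2 u) (Matrix.toEuclideanLin M (WithLp.toLp 2 v)) := by
    simp only [PiLp.inner_apply, Matrix.toLpLin_apply, Matrix.mulVec, dotProduct,
      RCLike.inner_apply, conj_trivial, Finset.sum_mul]
    exact Finset.sum_congr rfl fun i _ => Finset.sum_congr rfl fun j _ => by ring
  have h2 : ‖Matrix.toEuclideanLin M (WithLp.toLp 2 v)‖ ≤ opNorm M * ‖WithLp.toLp 2 v‖ :=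
    (LinearMap.toContinuousLinearMap (Matrix.toEuclideanLin M)).le_opNorm _
  have e : ∀ {p : ℕ} (z : Fin p → ℝ),
      ‖(WithLp.toLp 2 z : EuclideanSpace ℝ (Fin p))‖ = Real.sqrt (∑ i, z i ^ 2) := fun z => by
    rw [EuclideanSpace.norm_eq]
    simp
  rw [h1]
  refine (real_inner_le_norm _ _).trans ?_
  refine (mul_le_mul_of_nonneg_left h2 (norm_nonneg _)).trans (le_of_eq ?_)
  rw [e, e]
  ring

theorem sum_sqrt_mul_sqrt_le {κ : Type*} [Fintype κ] {x y : κ → ℝ} (hx : ∀ l, 0 ≤ x l)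
    (hy : ∀ l, 0 ≤ y l) {a b : ℝ} (ha : 0 ≤ a) (hb : 0 ≤ b) {M N : ℝ} (hM : 0 ≤ M)
    (hxa : ∑ l, x l ≤ M * a ^ 2) (hyb : ∑ l, y l ≤ N * b ^ 2) :
    ∑ l, Real.sqrt (x l) * Real.sqrt (y l) ≤ Real.sqrt (M * N) * (a * b) := by
  refine (Real.sum_sqrt_mul_sqrt_le _ hx hy).trans ?_
  refine (mul_le_mul (Real.sqrt_le_sqrt hxa) (Real.sqrt_le_sqrt hyb) (Real.sqrt_nonneg _)
    (Real.sqrt_nonneg _)).trans (le_of_eq ?_)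
  rw [Real.sqrt_mul' _ (sq_nonneg a), Real.sqrt_mul' _ (sq_nonneg b), Real.sqrt_sq ha,
    Real.sqrt_sq hb, Real.sqrt_mul hM]
  ring

theorem sum_comm_sq_le {κ : Type*} [Fintype κ] (U : Fin m → κ → ℝ) {a : ℝ}
    (hU : ∀ i, ∑ l, U i l ^ 2 ≤ a ^ 2) : ∑ l, ∑ i, U i l ^ 2 ≤ (m : ℝ) * a ^ 2 := by
  rw [Finset.sum_comm]
  refine (Finset.sum_le_sum fun i _ => hU i).trans (le_of_eq ?_)
  simp

/-- Duality between the spectral norm and factorizations with bounded rows. -/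
theorem pairing_le_opNorm {κ : Type*} [Fintype κ] (M : Matrix (Fin m) (Fin n) ℝ)
    (U : Fin m → κ → ℝ) (V : Fin n → κ → ℝ) {a b : ℝ} (ha : 0 ≤ a) (hb : 0 ≤ b)
    (hU : ∀ i, ∑ l, U i l ^ 2 ≤ a ^ 2) (hV : ∀ j, ∑ l, V j l ^ 2 ≤ b ^ 2) :
    ∑ i, ∑ j, M i j * ∑ l, U i l * V j l ≤
      opNorm M * (Real.sqrt ((m : ℝ) * n) * (a * b)) := by
  have e : ∑ i, ∑ j, M i j * ∑ l, U i l * V j l =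
      ∑ l, ∑ i, ∑ j, M i j * (U i l * V j l) := by
    simp only [Finset.mul_sum]
    conv_rhs => rw [Finset.sum_comm]
    exact Finset.sum_congr rfl fun i _ => Finset.sum_comm
  rw [e]
  refine (Finset.sum_le_sum fun l _ => bilin_le_opNorm M (fun i => U i l) fun j => V j l).trans ?_
  rw [← Finset.mul_sum]
  exact mul_le_mul_of_nonneg_left (sum_sqrt_mul_sqrt_le
    (fun l => Finset.sum_nonneg fun _ _ => sq_nonneg _)
    (fun l => Finset.sum_nonneg fun _ _ => sq_nonneg _) ha hb (Nat.cast_nonneg m)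
    (sum_comm_sq_le U hU) (sum_comm_sq_le V hV)) (opNorm_nonneg M)

theorem sum_prod_sq_le {k k' : ℕ} (U : Matrix (Fin m) (Fin k) ℝ) (U' : Matrix (Fin m) (Fin k') ℝ)
    (i : Fin m) : ∑ l : Fin k × Fin k', (U i l.1 * U' i l.2) ^ 2 ≤
      (twoInftyNorm U * twoInftyNorm U') ^ 2 := by
  simp only [mul_pow]
  rw [Fintype.sum_prod_type]
  change ∑ x, ∑ y, U i x ^ 2 * U' i y ^ 2 ≤ _
  rw [← Finset.sum_mul_sum]
  exact mul_le_mul (sum_sq_le_twoInftyNorm_sq U i) (sum_sq_le_twoInftyNorm_sq U' i)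
    (Finset.sum_nonneg fun _ _ => sq_nonneg _) (sq_nonneg _)

/-- The pairing of a matrix with an entrywise product of two matrices of small max norm. -/
theorem pairing_hadamard_le (M : Matrix (Fin m) (Fin n) ℝ) {A B : Matrix (Fin m) (Fin n) ℝ}
    {β : ℝ} (hA : maxNorm A ≤ β) (hB : maxNorm B ≤ β) :
    ∑ i, ∑ j, M i j * (A i j * B i j) ≤ opNorm M * Real.sqrt ((m : ℝ) * n) * β ^ 2 := by
  have hβ : 0 ≤ β := (maxNorm_nonneg A).trans hA
  have hM := opNorm_nonneg M
  rw [sq, ← mul_assoc]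
  refine le_mul_of_maxNorm_le hB (by positivity) fun k' U' V' hUV' => ?_
  have hU' := twoInftyNorm_nonneg U'
  have hV' := twoInftyNorm_nonneg V'
  rw [show opNorm M * Real.sqrt ((m : ℝ) * n) * β * (twoInftyNorm U' * twoInftyNorm V') =
    (opNorm M * Real.sqrt ((m : ℝ) * n) * (twoInftyNorm U' * twoInftyNorm V')) * β by ring]
  refine le_mul_of_maxNorm_le hA (by positivity) fun k U V hUV => ?_
  have hU := twoInftyNorm_nonneg U
  have hV := twoInftyNorm_nonneg V
  have e : ∀ i j, A i j * B i j =
      ∑ l : Fin k × Fin k', (U i l.1 * U' i l.2) * (V j l.1 * V' j l.2) := by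
    intro i j
    rw [hUV, hUV', mul_transpose_apply, mul_transpose_apply, Fintype.sum_prod_type,
      Finset.sum_mul_sum]
    exact Finset.sum_congr rfl fun _ _ => Finset.sum_congr rfl fun _ _ => by ring
  simp only [e]
  refine (pairing_le_opNorm M (fun i (l : Fin k × Fin k') => U i l.1 * U' i l.2)
    (fun j l => V j l.1 * V' j l.2) (mul_nonneg hU hU') (mul_nonneg hV hV')
    (sum_prod_sq_le U U') (sum_prod_sq_le V V')).trans (le_of_eq ?_)
  ring

theorem opNorm_neg (M : Matrix (Fin m) (Fin n) ℝ) : opNorm (-M) = opNorm M := by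
  simp [opNorm]

/-- Expand the square into A∘A, −2 A∘B and B∘B; the coefficients 1, 2, 1 in modulus give the factor
4. -/
theorem pairing_hadamard_sub_sq_le (M : Matrix (Fin m) (Fin n) ℝ)
    {A B : Matrix (Fin m) (Fin n) ℝ} {β : ℝ} (hA : maxNorm A ≤ β) (hB : maxNorm B ≤ β) :
    -∑ i, ∑ j, M i j * (A i j - B i j) ^ 2 ≤
      4 * (opNorm M * Real.sqrt ((m : ℝ) * n) * β ^ 2) := by
  have h1 := pairing_hadamard_le (-M) hA hA
  have h2 := pairing_hadamard_le (-M) hB hB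
  have h3 := pairing_hadamard_le M hA hB
  rw [opNorm_neg] at h1 h2
  have e : -∑ i, ∑ j, M i j * (A i j - B i j) ^ 2 =
      ∑ i, ∑ j, (-M) i j * (A i j * A i j) + ∑ i, ∑ j, (-M) i j * (B i j * B i j) +
        2 * ∑ i, ∑ j, M i j * (A i j * B i j) := by
    simp only [← Finset.sum_neg_distrib, Finset.mul_sum, ← Finset.sum_add_distrib,
      Matrix.neg_apply]
    exact Finset.sum_congr rfl fun _ _ => Finset.sum_congr rfl fun _ _ => by ring
  linarith

end MaxNorm

/-! ### The nuclear norm on the max-norm ball. -/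

section Nuclear

/-- Bessel's inequality for orthogonal vectors of norm at most 1. Zero vectors must be allowed, for
vanishing singular values. -/
theorem sum_inner_sq_le_of_orthogonal {ι E : Type*} [Fintype ι] [NormedAddCommGroup E]
    [InnerProductSpace ℝ E] {u : ι → E} (h1 : ∀ i, ‖u i‖ ≤ 1)
    (h2 : ∀ i j, i ≠ j → inner ℝ (u i) (u j) = 0) (x : E) :
    ∑ i, inner ℝ (u i) x ^ 2 ≤ ‖x‖ ^ 2 := by
  set s : E := ∑ i, inner ℝ (u i) x • u i with hs
  have hsx : inner ℝ s x = ∑ i, inner ℝ (u i) x ^ 2 := by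
    rw [hs, sum_inner]
    exact Finset.sum_congr rfl fun i _ => by rw [real_inner_smul_left, sq]
  have hss : inner ℝ s s ≤ ∑ i, inner ℝ (u i) x ^ 2 := by
    conv_lhs => rw [hs, sum_inner]
    refine Finset.sum_le_sum fun i _ => ?_
    rw [inner_sum, Finset.sum_eq_single i]
    · rw [real_inner_smul_left, real_inner_smul_right, real_inner_self_eq_norm_sq]
      have := pow_le_one₀ (norm_nonneg _) (h1 i) (n := 2)
      nlinarith [sq_nonneg (inner ℝ (u i) x)]
    · intro j _ hj
      rw [real_inner_smul_left, real_inner_smul_right, h2 i j hj.symm]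
      simp
    · simp
  have h := real_inner_self_nonneg (x := x - s)
  rw [inner_sub_left, inner_sub_right, inner_sub_right, real_inner_self_eq_norm_sq x,
    real_inner_comm s x, hsx] at h
  linarith

variable {m n : ℕ}

theorem nuclearNorm_nonneg (A : Matrix (Fin m) (Fin n) ℝ) : 0 ≤ nuclearNorm A :=
  Finset.sum_nonneg fun k _ => LinearMap.singularValues_nonneg _ k

theorem nuclearNorm_mul_transpose_le {k : ℕ} (U : Matrix (Fin m) (Fin k) ℝ)
    (V : Matrix (Fin n) (Fin k) ℝ) :
    nuclearNorm (U * Vᵀ) ≤ Real.sqrt ((m : ℝ) * n) * (twoInftyNorm U * twoInftyNorm V) := by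
  set f := Matrix.toEuclideanLin (U * Vᵀ) with hf
  have hfin : Module.finrank ℝ (EuclideanSpace ℝ (Fin n)) = n := by simp
  set b := f.isSymmetric_adjoint_comp_self.eigenvectorBasis hfin with hb
  set σ : Fin n → ℝ := fun i => f.singularValues i with hσ
  have hσ0 : ∀ i, 0 ≤ σ i := fun i => f.singularValues_nonneg _
  have hinner : ∀ i j, inner ℝ (f (b i)) (f (b j)) = if i = j then σ i ^ 2 else 0 := by
    intro i j
    rw [← LinearMap.adjoint_inner_left, ← LinearMap.comp_apply,
      f.isSymmetric_adjoint_comp_self.apply_eigenvectorBasis hfin i, hσ]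
    simp only [f.sq_singularValues_fin hfin]
    rw [RCLike.ofReal_real_eq_id, id, real_inner_smul_left, ← hb,
      orthonormal_iff_ite.1 b.orthonormal i j]
    split_ifs <;> simp
  -- Left singular vectors; since 0⁻¹ = 0 they vanish where σ does. Then σ i = ⟨u i, U Vᵀ b i⟩
  -- expands over the columns of U and V, and Cauchy–Schwarz in i with Bessel on both sides bounds
  -- each column's share.
  set u : Fin n → EuclideanSpace ℝ (Fin m) := fun i => (σ i)⁻¹ • f (b i) with hu
  have hu1 : ∀ i, ‖u i‖ ≤ 1 := by
    intro i
    refine le_of_sq_le_sq ?_ zero_le_one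
    rw [← real_inner_self_eq_norm_sq, hu, real_inner_smul_left, real_inner_smul_right, hinner,
      if_pos rfl]
    rcases eq_or_ne (σ i) 0 with h | h
    · simp [h]
    · field_simp
      norm_num
  have hu2 : ∀ i j, i ≠ j → inner ℝ (u i) (u j) = 0 := by
    intro i j hij
    rw [hu, real_inner_smul_left, real_inner_smul_right, hinner, if_neg hij]
    simp
  have hσu : ∀ i, σ i = inner ℝ (u i) (f (b i)) := by
    intro i
    rw [hu, real_inner_smul_left, hinner, if_pos rfl]
    rcases eq_or_ne (σ i) 0 with h | h
    · simp [h]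
    · field_simp
  have hfact : ∀ i, σ i = ∑ l, inner ℝ (u i) (WithLp.toLp 2 fun a => U a l) *
      inner ℝ (b i) (WithLp.toLp 2 fun a => V a l) := by
    intro i
    rw [hσu i, hf]
    simp only [PiLp.inner_apply, Matrix.toLpLin_apply, ← Matrix.mulVec_mulVec, Matrix.mulVec,
      dotProduct, RCLike.inner_apply, conj_trivial, Finset.sum_mul, Matrix.transpose_apply]
    rw [Finset.sum_comm]
    refine Finset.sum_congr rfl fun l _ => Finset.sum_congr rfl fun a _ => ?_
    ring
  have e : nuclearNorm (U * Vᵀ) = ∑ i, σ i := by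
    rw [nuclearNorm, ← hf, Finset.sum_range]
  have hl : ∀ l, ∑ i, inner ℝ (u i) (WithLp.toLp 2 fun a => U a l) *
      inner ℝ (b i) (WithLp.toLp 2 fun a => V a l) ≤
      Real.sqrt (∑ a, U a l ^ 2) * Real.sqrt (∑ a, V a l ^ 2) := by
    intro l
    refine (Real.sum_mul_le_sqrt_mul_sqrt _ _ _).trans ?_
    refine mul_le_mul (Real.sqrt_le_sqrt ?_) (Real.sqrt_le_sqrt ?_) (Real.sqrt_nonneg _)
      (Real.sqrt_nonneg _)
    · refine (sum_inner_sq_le_of_orthogonal hu1 hu2 _).trans (le_of_eq ?_)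
      rw [EuclideanSpace.real_norm_sq_eq]
    · refine (sum_inner_sq_le_of_orthogonal (fun i => (b.norm_eq_one i).le)
        (fun i j hij => b.orthonormal.2 hij) _).trans (le_of_eq ?_)
      rw [EuclideanSpace.real_norm_sq_eq]
  rw [e]
  simp only [hfact]
  rw [Finset.sum_comm]
  refine (Finset.sum_le_sum fun l _ => hl l).trans ?_
  exact sum_sqrt_mul_sqrt_le (fun l => Finset.sum_nonneg fun _ _ => sq_nonneg _)
    (fun l => Finset.sum_nonneg fun _ _ => sq_nonneg _) (twoInftyNorm_nonneg U)
    (twoInftyNorm_nonneg V) (Nat.cast_nonneg m)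
    (sum_comm_sq_le U (sum_sq_le_twoInftyNorm_sq U))
    (sum_comm_sq_le V (sum_sq_le_twoInftyNorm_sq V))

theorem nuclearNorm_le_of_maxNorm_le {A : Matrix (Fin m) (Fin n) ℝ} {β : ℝ}
    (hA : maxNorm A ≤ β) : nuclearNorm A ≤ Real.sqrt ((m : ℝ) * n) * β :=
  le_mul_of_maxNorm_le hA (Real.sqrt_nonneg _) fun k U V hUV => by
    rw [hUV]
    exact nuclearNorm_mul_transpose_le U V

end Nuclear

/-! ### Grothendieck's inequality by truncated Rademacher sums. -/

section Grothendieck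

variable {m n : ℕ}

/-- The sign encoded by a Boolean. -/
def boolSign (b : Bool) : ℝ := if b then 1 else -1

theorem boolSign_sq (b : Bool) : boolSign b ^ 2 = 1 := by cases b <;> simp [boolSign]

theorem exists_boolSign_mul_eq_abs (x : ℝ) : ∃ b, boolSign b * x = |x| := by
  rcases le_total 0 x with h | h
  · exact ⟨true, by simp [boolSign, abs_of_nonneg h]⟩
  · exact ⟨false, by simp [boolSign, abs_of_nonpos h]⟩

/-- A bilinear form on a cube is controlled by its values at sign vectors. -/
theorem bilin_le_of_signs {G : Fin m → Fin n → ℝ} {b : ℝ}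
    (h : ∀ (s : Fin m → Bool) (t : Fin n → Bool),
      ∑ i, ∑ j, G i j * (boolSign (s i) * boolSign (t j)) ≤ b)
    {R : ℝ} (hR : 0 ≤ R) {x : Fin m → ℝ} {y : Fin n → ℝ} (hx : ∀ i, |x i| ≤ R)
    (hy : ∀ j, |y j| ≤ R) : ∑ i, ∑ j, G i j * (x i * y j) ≤ R ^ 2 * b := by
  choose t ht using fun j => exists_boolSign_mul_eq_abs (∑ i, G i j * x i)
  choose s hs using fun i => exists_boolSign_mul_eq_abs (∑ j, G i j * boolSign (t j))
  have h1 : ∑ i, ∑ j, G i j * (x i * y j) ≤ R * ∑ i, x i * ∑ j, G i j * boolSign (t j) := by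
    calc ∑ i, ∑ j, G i j * (x i * y j) = ∑ j, y j * ∑ i, G i j * x i := by
          rw [Finset.sum_comm]
          refine Finset.sum_congr rfl fun j _ => ?_
          rw [Finset.mul_sum]
          exact Finset.sum_congr rfl fun i _ => by ring
      _ ≤ ∑ j, R * (boolSign (t j) * ∑ i, G i j * x i) := by
          refine Finset.sum_le_sum fun j _ => ?_
          rw [ht]
          refine (le_abs_self _).trans ?_
          rw [abs_mul]
          exact mul_le_mul_of_nonneg_right (hy j) (abs_nonneg _)
      _ = R * ∑ i, x i * ∑ j, G i j * boolSign (t j) := by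
          rw [← Finset.mul_sum]
          congr 1
          simp only [Finset.mul_sum]
          rw [Finset.sum_comm]
          exact Finset.sum_congr rfl fun _ _ => Finset.sum_congr rfl fun _ _ => by ring
  have h2 : ∑ i, x i * ∑ j, G i j * boolSign (t j) ≤
      R * ∑ i, ∑ j, G i j * (boolSign (s i) * boolSign (t j)) := by
    rw [Finset.mul_sum]
    refine Finset.sum_le_sum fun i _ => ?_
    have e : ∑ j, G i j * (boolSign (s i) * boolSign (t j)) =
        |∑ j, G i j * boolSign (t j)| := by
      rw [← hs, Finset.mul_sum]
      exact Finset.sum_congr rfl fun _ _ => by ring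
    rw [e]
    refine (le_abs_self _).trans ?_
    rw [abs_mul]
    exact mul_le_mul_of_nonneg_right (hx i) (abs_nonneg _)
  calc _ ≤ R * ∑ i, x i * ∑ j, G i j * boolSign (t j) := h1
    _ ≤ R * (R * ∑ i, ∑ j, G i j * (boolSign (s i) * boolSign (t j))) :=
        mul_le_mul_of_nonneg_left h2 hR
    _ ≤ R * (R * b) := by
        gcongr
        exact h s t
    _ = R ^ 2 * b := by ring

/-- The expectation over independent uniform signs. -/
noncomputable def signExp (k : ℕ) (F : (Fin k → Bool) → ℝ) : ℝ := bernExp (fun _ => 1 / 2) F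

/-- The Rademacher sum with coefficients `u`. -/
def signSum {k : ℕ} (u : Fin k → ℝ) (S : Fin k → Bool) : ℝ := ∑ l, u l * boolSign (S l)

theorem signExp_mono {k : ℕ} {F G : (Fin k → Bool) → ℝ} (h : ∀ S, F S ≤ G S) :
    signExp k F ≤ signExp k G :=
  bernExp_mono (fun _ => by norm_num) (fun _ => by norm_num) h

theorem signExp_boolSign_mul {k : ℕ} {l l' : Fin k} (h : l ≠ l') :
    signExp k (fun S => boolSign (S l) * boolSign (S l')) = 0 := by
  have h0 : ∀ _ : Fin k, (0 : ℝ) ≤ 1 / 2 := fun _ => by norm_num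
  have h1 : ∀ _ : Fin k, (1 / 2 : ℝ) ≤ 1 := fun _ => by norm_num
  have hpair : ∀ S : Fin k → Bool, S l = true →
      boolSign (Function.update S l false l) * boolSign (Function.update S l false l') =
      -(boolSign (S l) * boolSign (S l')) := by
    intro S hS
    rw [Function.update_self, Function.update_of_ne h.symm, hS]
    cases S l' <;> simp [boolSign]
  have e : bernExp (fun _ : Fin k => (1 / 2 : ℝ)) (fun _ => 0) = 0 := bernExp_const _ 0
  refine le_antisymm ?_ ?_
  · rw [signExp, ← e]
    refine bernExp_le_of_pairs h0 h1 l fun S hS => ?_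
    rw [hpair S hS]
    ring_nf
    exact le_rfl
  · rw [signExp, ← e]
    refine bernExp_le_of_pairs h0 h1 l fun S hS => ?_
    rw [hpair S hS]
    ring_nf
    exact le_rfl

theorem signExp_signSum_mul {k : ℕ} (u v : Fin k → ℝ) :
    signExp k (fun S => signSum u S * signSum v S) = ∑ l, u l * v l := by
  have e : ∀ S : Fin k → Bool, signSum u S * signSum v S =
      ∑ l, ∑ l', (u l * v l') * (boolSign (S l) * boolSign (S l')) := by
    intro S
    rw [signSum, signSum, Finset.sum_mul_sum]
    exact Finset.sum_congr rfl fun _ _ => Finset.sum_congr rfl fun _ _ => by ring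
  simp only [e, signExp, bernExp_sum, bernExp_const_mul]
  refine Finset.sum_congr rfl fun l _ => ?_
  rw [Finset.sum_eq_single l]
  · simp only [← sq, boolSign_sq, bernExp_const, mul_one]
  · intro l' _ hl'
    have := signExp_boolSign_mul hl'.symm
    rw [signExp] at this
    rw [this, mul_zero]
  · simp

theorem signExp_exp_signSum_le {k : ℕ} {u : Fin k → ℝ} (hu : ∑ l, u l ^ 2 ≤ 1) :
    signExp k (fun S => Real.exp (signSum u S)) ≤ Real.exp (1 / 2) := by
  simp only [signSum, Real.exp_sum, signExp]
  rw [bernExp_prod _ fun l b => Real.exp (u l * boolSign b)]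
  have h : ∀ l, 1 / 2 * Real.exp (u l * boolSign true) +
      (1 - 1 / 2) * Real.exp (u l * boolSign false) ≤ Real.exp (u l ^ 2 / 2) := by
    intro l
    have := Real.cosh_le_exp_half_sq (u l)
    rw [Real.cosh_eq] at this
    simp only [boolSign, if_true, Bool.false_eq_true, if_false, mul_one, mul_neg]
    linarith
  refine (Finset.prod_le_prod (fun l _ => by positivity) fun l _ => h l).trans ?_
  rw [← Real.exp_sum, ← Finset.sum_div]
  exact Real.exp_le_exp.2 (by linarith)

/-- Truncation at level `9`. -/
def clip (x : ℝ) : ℝ := max (-9) (min 9 x)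

theorem abs_clip_le (x : ℝ) : |clip x| ≤ 9 :=
  abs_le.2 ⟨le_max_left _ _, max_le (by norm_num) (min_le_left _ _)⟩

theorem clip_sq_le (x : ℝ) : clip x ^ 2 ≤ x ^ 2 := by
  unfold clip
  rcases le_total 9 x with h | h
  · rw [min_eq_left h, max_eq_right (by norm_num)]
    nlinarith
  · rw [min_eq_right h]
    rcases le_total (-9) x with h' | h'
    · rw [max_eq_right h']
    · rw [max_eq_left h']
      nlinarith

/-- From (|x| − 18)² ≥ 0 comes 36(|x| − 9) ≤ x²; square it and use 16/36² = 1/81. -/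
theorem sub_clip_sq_le (x : ℝ) : 16 * (x - clip x) ^ 2 ≤ x ^ 4 / 81 := by
  have h0 : 0 ≤ x ^ 4 := by positivity
  unfold clip
  rcases le_total 9 x with h | h
  · rw [min_eq_left h, max_eq_right (by norm_num)]
    have h1 : 36 * (x - 9) ≤ x ^ 2 := by nlinarith [sq_nonneg (x - 18)]
    have h2 := pow_le_pow_left₀ (by linarith) h1 2
    nlinarith
  · rw [min_eq_right h]
    rcases le_total (-9) x with h' | h'
    · rw [max_eq_right h']
      simp only [sub_self]
      norm_num
      linarith
    · rw [max_eq_left h']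
      have h1 : 36 * (-x - 9) ≤ x ^ 2 := by nlinarith [sq_nonneg (x + 18)]
      have h2 := pow_le_pow_left₀ (by linarith) h1 2
      nlinarith

theorem pow_four_le_exp_add_exp (x : ℝ) : x ^ 4 ≤ 24 * (Real.exp x + Real.exp (-x)) := by
  have h := Real.pow_div_factorial_le_exp |x| (abs_nonneg x) 4
  have e : |x| ^ 4 = x ^ 4 := (by decide : Even 4).pow_abs x
  rw [e] at h
  have h2 : Real.exp |x| ≤ Real.exp x + Real.exp (-x) := by
    rcases abs_cases x with ⟨h, -⟩ | ⟨h, -⟩ <;> rw [h] <;>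
      linarith [Real.exp_pos x, Real.exp_pos (-x)]
  norm_num [Nat.factorial] at h
  linarith

/-- The truncation remainder has L² norm at most 1/4. Level 9 is tuned to this: (24/81) · 2 ·
(27/16) = 1, where exp(1/2) ≤ 27/16. -/
theorem signExp_sub_clip_sq_le {k : ℕ} {u : Fin k → ℝ} (hu : ∑ l, u l ^ 2 ≤ 1) :
    signExp k (fun S => (4 * (signSum u S - clip (signSum u S))) ^ 2) ≤ 1 := by
  have h1 : ∀ S, (4 * (signSum u S - clip (signSum u S))) ^ 2 ≤
      24 / 81 * (Real.exp (signSum u S) + Real.exp (signSum (fun l => -u l) S)) := by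
    intro S
    have e : signSum (fun l => -u l) S = -signSum u S := by simp [signSum]
    rw [e]
    have := sub_clip_sq_le (signSum u S)
    have := pow_four_le_exp_add_exp (signSum u S)
    nlinarith
  refine (signExp_mono h1).trans ?_
  have e2 : signExp k (fun S => 24 / 81 * (Real.exp (signSum u S) +
      Real.exp (signSum (fun l => -u l) S))) = 24 / 81 * (signExp k (fun S =>
        Real.exp (signSum u S)) + signExp k (fun S => Real.exp (signSum (fun l => -u l) S))) := by
    simp only [signExp]
    rw [bernExp_const_mul, bernExp_add]
  rw [e2]
  have h2 := signExp_exp_signSum_le hu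
  have h3 := signExp_exp_signSum_le (u := fun l => -u l) (by simpa using hu)
  have h4 : Real.exp (1 / 2) ≤ 27 / 16 := by
    have h5 : Real.exp (1 / 2) ^ 2 = Real.exp 1 := by
      rw [← Real.exp_nat_mul]
      norm_num
    have := Real.exp_one_lt_d9
    exact le_of_sq_le_sq (by rw [h5]; norm_num; linarith) (by norm_num)
  linarith

/-- The values of the pairing with Gram-type matrices with rows in the unit ball. -/
def gramValues (G : Fin m → Fin n → ℝ) : Set ℝ :=
  {x | ∃ (k : ℕ) (U : Fin m → Fin k → ℝ) (V : Fin n → Fin k → ℝ),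
    (∀ i, ∑ l, U i l ^ 2 ≤ 1) ∧ (∀ j, ∑ l, V j l ^ 2 ≤ 1) ∧
      x = ∑ i, ∑ j, G i j * ∑ l, U i l * V j l}

theorem gramValues_bddAbove (G : Fin m → Fin n → ℝ) : BddAbove (gramValues G) := by
  refine ⟨∑ i, ∑ j, |G i j|, ?_⟩
  rintro _ ⟨k, U, V, hU, hV, rfl⟩
  refine Finset.sum_le_sum fun i _ => Finset.sum_le_sum fun j _ => ?_
  refine (le_abs_self _).trans ?_
  rw [abs_mul]
  refine mul_le_of_le_one_right (abs_nonneg _) (abs_le_of_sq_le_sq ?_ zero_le_one)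
  refine (Finset.sum_mul_sq_le_sq_mul_sq _ _ _).trans ?_
  rw [one_pow]
  exact mul_le_one₀ (hU i) (Finset.sum_nonneg fun _ _ => sq_nonneg _) (hV j)

theorem mem_gramValues {κ : Type} [Fintype κ] (G : Fin m → Fin n → ℝ) (U : Fin m → κ → ℝ)
    (V : Fin n → κ → ℝ) (hU : ∀ i, ∑ l, U i l ^ 2 ≤ 1) (hV : ∀ j, ∑ l, V j l ^ 2 ≤ 1) :
    ∑ i, ∑ j, G i j * ∑ l, U i l * V j l ∈ gramValues G := by
  set e := (Fintype.equivFin κ).symm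
  refine ⟨Fintype.card κ, fun i l => U i (e l), fun j l => V j (e l), fun i => ?_, fun j => ?_, ?_⟩
  · rw [e.sum_comp fun l => U i l ^ 2]
    exact hU i
  · rw [e.sum_comp fun l => V j l ^ 2]
    exact hV j
  · refine Finset.sum_congr rfl fun i _ => Finset.sum_congr rfl fun j _ => ?_
    rw [e.sum_comp fun l => U i l * V j l]

/-- Random variables on the sign cube are vectors with 2^k coordinates, each scaled by the square
root of its probability. So L² pairings are again Gram values, which closes the self-bounding
argument. -/
theorem signExp_mem_gramValues {k : ℕ} (G : Fin m → Fin n → ℝ) (X : Fin m → (Fin k → Bool) → ℝ)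
    (Y : Fin n → (Fin k → Bool) → ℝ) (hX : ∀ i, signExp k (fun S => X i S ^ 2) ≤ 1)
    (hY : ∀ j, signExp k (fun S => Y j S ^ 2) ≤ 1) :
    ∑ i, ∑ j, G i j * signExp k (fun S => X i S * Y j S) ∈ gramValues G := by
  set w : (Fin k → Bool) → ℝ := fun S => Real.sqrt (bernWeight (fun _ => 1 / 2) S)
  have hw : ∀ S, w S ^ 2 = bernWeight (fun _ => 1 / 2) S := fun S =>
    Real.sq_sqrt (bernWeight_nonneg (fun _ => by norm_num) (fun _ => by norm_num) S)
  have e : ∀ F H : (Fin k → Bool) → ℝ, signExp k (fun S => F S * H S) =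
      ∑ S, (w S * F S) * (w S * H S) := by
    intro F H
    rw [signExp, bernExp]
    exact Finset.sum_congr rfl fun S _ => by rw [← hw]; ring
  simp only [sq, e] at hX hY
  simp only [e]
  exact mem_gramValues G (fun i S => w S * X i S) (fun j S => w S * Y j S)
    (by simpa only [sq] using hX) (by simpa only [sq] using hY)

/-- **Grothendieck's inequality**, with a non-optimal constant. -/
theorem grothendieck {G : Fin m → Fin n → ℝ} {b : ℝ}
    (h : ∀ (s : Fin m → Bool) (t : Fin n → Bool),
      ∑ i, ∑ j, G i j * (boolSign (s i) * boolSign (t j)) ≤ b) {x : ℝ} (hx : x ∈ gramValues G) :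
    x ≤ 162 * b := by
  set M := sSup (gramValues G) with hM
  have hle : ∀ y ∈ gramValues G, y ≤ M := fun y hy => le_csSup (gramValues_bddAbove G) hy
  -- Inner products are covariances of Rademacher sums. Truncating both factors gives a form on a
  -- cube of side 9, at most 81b by sign vectors; the two terms with a remainder cost M/4 each.
  -- Hence M ≤ 81b + M/2.
  have key : ∀ y ∈ gramValues G, y ≤ 81 * b + M / 2 := by
    rintro _ ⟨k, U, V, hU, hV, rfl⟩
    have hg2 : ∀ u : Fin k → ℝ, ∑ l, u l ^ 2 ≤ 1 → signExp k (fun S => signSum u S ^ 2) ≤ 1 := by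
      intro u hu
      simp only [sq, signExp_signSum_mul]
      simpa only [sq] using hu
    have hc2 : ∀ u : Fin k → ℝ, ∑ l, u l ^ 2 ≤ 1 →
        signExp k (fun S => clip (signSum u S) ^ 2) ≤ 1 := fun u hu =>
      (signExp_mono fun S => clip_sq_le _).trans (hg2 u hu)
    have m1 := hle _ (signExp_mem_gramValues G
      (fun i S => 4 * (signSum (U i) S - clip (signSum (U i) S)))
      (fun j S => signSum (V j) S) (fun i => signExp_sub_clip_sq_le (hU i)) fun j => hg2 _ (hV j))
    have m2 := hle _ (signExp_mem_gramValues G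
      (fun i S => clip (signSum (U i) S))
      (fun j S => 4 * (signSum (V j) S - clip (signSum (V j) S)))
      (fun i => hc2 _ (hU i)) fun j => signExp_sub_clip_sq_le (hV j))
    have m3 : signExp k (fun S => ∑ i, ∑ j, G i j *
        (clip (signSum (U i) S) * clip (signSum (V j) S))) ≤ 81 * b := by
      rw [show 81 * b = signExp k (fun _ => 9 ^ 2 * b) by rw [signExp, bernExp_const]; norm_num]
      exact signExp_mono fun S => bilin_le_of_signs h (by norm_num) (fun i => abs_clip_le _)
        fun j => abs_clip_le _
    have split : ∀ i j, ∑ l, U i l * V j l =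
        signExp k (fun S => clip (signSum (U i) S) * clip (signSum (V j) S)) +
        1 / 4 * signExp k (fun S => 4 * (signSum (U i) S - clip (signSum (U i) S)) *
          signSum (V j) S) +
        1 / 4 * signExp k (fun S => clip (signSum (U i) S) *
          (4 * (signSum (V j) S - clip (signSum (V j) S)))) := by
      intro i j
      rw [← signExp_signSum_mul]
      simp only [signExp]
      rw [← bernExp_const_mul, ← bernExp_const_mul, ← bernExp_add, ← bernExp_add]
      congr 1
      funext S
      ring
    have m3' : ∑ i, ∑ j, G i j *
        signExp k (fun S => clip (signSum (U i) S) * clip (signSum (V j) S)) ≤ 81 * b := by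
      refine le_trans (le_of_eq ?_) m3
      simp only [signExp, bernExp_sum, bernExp_const_mul]
    simp only [split, mul_add, Finset.sum_add_distrib]
    simp only [mul_left_comm _ (1 / 4 : ℝ), ← Finset.mul_sum]
    linarith
  have hMle : M ≤ 81 * b + M / 2 := csSup_le ⟨x, hx⟩ key
  linarith [hle x hx]

/-- The pairing with a matrix of bounded max norm is controlled by sign vectors. -/
theorem pairing_le_of_signs {G A : Matrix (Fin m) (Fin n) ℝ} {b β : ℝ} (hb : 0 ≤ b)
    (h : ∀ (s : Fin m → Bool) (t : Fin n → Bool),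
      ∑ i, ∑ j, G i j * (boolSign (s i) * boolSign (t j)) ≤ b) (hA : maxNorm A ≤ β) :
    ∑ i, ∑ j, G i j * A i j ≤ 162 * b * β := by
  refine le_mul_of_maxNorm_le hA (by positivity) fun k U V hUV => ?_
  have hu0 := twoInftyNorm_nonneg U
  have hv0 := twoInftyNorm_nonneg V
  set a := twoInftyNorm U
  set c := twoInftyNorm V
  -- Rows are normalised with 0⁻¹ = 0. Nothing is lost, since a matrix of zero norm has zero
  -- entries, as `hentry` records.
  have hrow : ∀ {p : ℕ} (W : Matrix (Fin p) (Fin k) ℝ) (i : Fin p),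
      ∑ l, ((twoInftyNorm W)⁻¹ * W i l) ^ 2 ≤ 1 := by
    intro p W i
    simp only [mul_pow, ← Finset.mul_sum]
    rcases eq_or_ne (twoInftyNorm W) 0 with h0 | h0
    · simp [h0]
    · have := twoInftyNorm_nonneg W
      rw [inv_pow, inv_mul_le_iff₀ (by positivity), mul_one]
      exact sum_sq_le_twoInftyNorm_sq W i
  have hentry : ∀ {p : ℕ} (W : Matrix (Fin p) (Fin k) ℝ) (i : Fin p) (l : Fin k),
      W i l = twoInftyNorm W * ((twoInftyNorm W)⁻¹ * W i l) := by
    intro p W i l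
    rcases eq_or_ne (twoInftyNorm W) 0 with h0 | h0
    · have h1 := sum_sq_le_twoInftyNorm_sq W i
      have h2 : W i l ^ 2 ≤ ∑ l, W i l ^ 2 := Finset.single_le_sum (f := fun l => W i l ^ 2) (fun l _ => sq_nonneg _)
        (Finset.mem_univ l)
      rw [h0] at h1 ⊢
      have : W i l ^ 2 = 0 := le_antisymm (by linarith) (sq_nonneg _)
      simpa using this
    · field_simp
  have hmem : ∑ i, ∑ j, G i j * ∑ l, (a⁻¹ * U i l) * (c⁻¹ * V j l) ∈ gramValues G :=
    mem_gramValues G (fun i l => a⁻¹ * U i l) (fun j l => c⁻¹ * V j l) (hrow U) (hrow V)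
  have hG := grothendieck (G := G) h hmem
  have e : ∑ i, ∑ j, G i j * A i j =
      (a * c) * ∑ i, ∑ j, G i j * ∑ l, (a⁻¹ * U i l) * (c⁻¹ * V j l) := by
    simp only [Finset.mul_sum]
    refine Finset.sum_congr rfl fun i _ => Finset.sum_congr rfl fun j _ => ?_
    rw [hUV, mul_transpose_apply, Finset.mul_sum]
    refine Finset.sum_congr rfl fun l _ => ?_
    conv_lhs => rw [hentry U i l, hentry V j l]
    ring
  rw [e, mul_comm (162 * b)]
  exact mul_le_mul_of_nonneg_left hG (mul_nonneg hu0 hv0)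

end Grothendieck

/-! ### From the ψ₂ norm to sub-Gaussian tails. -/

section SubGaussian

variable {Ω : Type*} [MeasurableSpace Ω] {P : Measure Ω}

/-- Convexity in θ: the chord from θ = 0 to θ = 1 lies above the exponential. -/
theorem exp_mul_le_one_add_mul {θ z : ℝ} (h0 : 0 ≤ θ) (h1 : θ ≤ 1) :
    Real.exp (θ * z) ≤ 1 + θ * (Real.exp z - 1) := by
  have h := _root_.rpow_one_add_le_one_add_mul_self (s := Real.exp z - 1)
    (by linarith [Real.exp_pos z]) h0 h1
  rw [add_sub_cancel, ← Real.exp_mul, mul_comm] at h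
  exact h

theorem integrable_exp_sq_of_psiTwoNorm_lt [IsProbabilityMeasure P] {X : Ω → ℝ}
    (hX : Measurable X) {t : ℝ} (h : psiTwoNorm X P < ENNReal.ofReal t) :
    Integrable (fun ω => Real.exp (X ω ^ 2 / t ^ 2)) P ∧
      ∫ ω, Real.exp (X ω ^ 2 / t ^ 2) ∂P ≤ 2 := by
  obtain ⟨_, ⟨t', ht', rfl, hint⟩, hlt⟩ := sInf_lt_iff.1 h
  have htt : t' < t := (ENNReal.ofReal_lt_ofReal_iff_of_nonneg ht'.le).1 hlt
  have hle : ∫⁻ ω, ENNReal.ofReal (Real.exp (X ω ^ 2 / t ^ 2)) ∂P ≤ 2 := by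
    refine (lintegral_mono fun ω => ENNReal.ofReal_le_ofReal (Real.exp_le_exp.2 ?_)).trans hint
    have : t' ^ 2 ≤ t ^ 2 := pow_le_pow_left₀ ht'.le htt.le 2
    exact div_le_div_of_nonneg_left (sq_nonneg _) (by positivity) this
  have hmeas : AEStronglyMeasurable (fun ω => Real.exp (X ω ^ 2 / t ^ 2)) P :=
    (by fun_prop : Measurable fun ω => Real.exp (X ω ^ 2 / t ^ 2)).aestronglyMeasurable
  have hnn : 0 ≤ᵐ[P] fun ω => Real.exp (X ω ^ 2 / t ^ 2) :=
    Filter.Eventually.of_forall fun ω => (Real.exp_pos _).le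
  refine ⟨⟨hmeas, ?_⟩, ?_⟩
  · rw [hasFiniteIntegral_iff_ofReal hnn]
    exact hle.trans_lt (by simp)
  · rw [integral_eq_lintegral_of_nonneg_ae hnn hmeas]
    exact ENNReal.toReal_le_of_le_ofReal (by norm_num) (by simpa using hle)

theorem mgf_le_of_psiTwoNorm_lt [IsProbabilityMeasure P] {X : Ω → ℝ} (hX : Measurable X)
    (hmean : ∫ ω, X ω ∂P = 0) {t : ℝ} (ht : 0 < t) (h : psiTwoNorm X P < ENNReal.ofReal t)
    (l : ℝ) : Integrable (fun ω => Real.exp (l * X ω)) P ∧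
      mgf X P l ≤ Real.exp (l ^ 2 * t ^ 2) := by
  obtain ⟨hint, hle⟩ := integrable_exp_sq_of_psiTwoNorm_lt hX h
  set Z : Ω → ℝ := fun ω => X ω ^ 2 / t ^ 2 with hZ
  have hZX : ∀ ω, Z ω * t ^ 2 = X ω ^ 2 := fun ω => div_mul_cancel₀ _ (by positivity)
  have hZ0 : ∀ ω, 0 ≤ Z ω := fun ω => by positivity
  have hZint1 : Integrable (fun ω => Real.exp (Z ω) - 1) P := hint.sub (integrable_const 1)
  have hXint : Integrable X P := by
    refine (hint.const_mul t).mono' hX.aestronglyMeasurable (Filter.Eventually.of_forall fun ω => ?_)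
    have h1 : |X ω| / t ≤ Z ω + 1 := by
      have : Z ω = (|X ω| / t) ^ 2 := by rw [hZ, div_pow, sq_abs]
      rw [this]
      nlinarith [sq_nonneg (|X ω| / t - 1), sq_nonneg (|X ω| / t)]
    have h2 := h1.trans (Real.add_one_le_exp (Z ω))
    rw [div_le_iff₀ ht] at h2
    rw [Real.norm_eq_abs]
    linarith
  have hmeas : Measurable fun ω => Real.exp (l * X ω) := by fun_prop
  have hIbound : ∀ c : ℝ, Integrable (fun ω => 1 + c * (Real.exp (Z ω) - 1)) P := fun c =>
    (integrable_const 1).add (hZint1.const_mul c)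
  have hEbound : ∀ c : ℝ, 0 ≤ c → ∫ ω, (1 + c * (Real.exp (Z ω) - 1)) ∂P ≤ 1 + c := by
    intro c hc
    rw [integral_add (integrable_const 1) (hZint1.const_mul c), integral_const_mul,
      integral_sub hint (integrable_const 1)]
    simp only [integral_const, probReal_univ, smul_eq_mul, mul_one]
    nlinarith
  -- For small l the mean-zero linear term drops out and the remainder averages to at most 1 + l²t².
  -- For large l, lX ≤ l²t²/2 + Z/2, and E exp(Z/2) ≤ 3/2 is absorbed by a second exp(l²t²/2).
  rcases le_total (l ^ 2 * t ^ 2) 1 with hc | hc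
  · have hθ0 : 0 ≤ l ^ 2 * t ^ 2 := by positivity
    have hpt : ∀ ω, Real.exp (l * X ω) ≤
        l * X ω + (1 + l ^ 2 * t ^ 2 * (Real.exp (Z ω) - 1)) := by
      intro ω
      have h1 := exp_le_add_exp_sq (l * X ω)
      have h2 := exp_mul_le_one_add_mul (z := Z ω) hθ0 hc
      have e : (l * X ω) ^ 2 = l ^ 2 * t ^ 2 * Z ω := by
        rw [mul_pow, ← hZX]
        ring
      rw [e] at h1
      linarith
    have hI := (hXint.const_mul l).add (hIbound (l ^ 2 * t ^ 2))
    have hexpint : Integrable (fun ω => Real.exp (l * X ω)) P :=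
      hI.mono' hmeas.aestronglyMeasurable (Filter.Eventually.of_forall fun ω => by
        rw [Real.norm_of_nonneg (Real.exp_pos _).le]
        exact hpt ω)
    refine ⟨hexpint, ?_⟩
    have h3 := integral_mono hexpint hI hpt
    simp only [Pi.add_apply] at h3
    rw [integral_add (hXint.const_mul l) (hIbound _), integral_const_mul, hmean, mul_zero,
      zero_add] at h3
    rw [mgf]
    linarith [hEbound _ hθ0, Real.add_one_le_exp (l ^ 2 * t ^ 2)]
  · have hpt : ∀ ω, Real.exp (l * X ω) ≤
        Real.exp (l ^ 2 * t ^ 2 / 2) * (1 + 1 / 2 * (Real.exp (Z ω) - 1)) := by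
      intro ω
      have h2 := exp_mul_le_one_add_mul (θ := 1 / 2) (z := Z ω) (by norm_num) (by norm_num)
      refine le_trans ?_ (mul_le_mul_of_nonneg_left h2 (Real.exp_pos _).le)
      rw [← Real.exp_add]
      refine Real.exp_le_exp.2 ?_
      have e : Z ω = (X ω / t) ^ 2 := by rw [hZ, div_pow]
      have e2 : l * X ω = (l * t) * (X ω / t) := by field_simp
      rw [e, e2]
      nlinarith [sq_nonneg (l * t - X ω / t)]
    have hI := (hIbound (1 / 2)).const_mul (Real.exp (l ^ 2 * t ^ 2 / 2))
    have hexpint : Integrable (fun ω => Real.exp (l * X ω)) P :=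
      hI.mono' hmeas.aestronglyMeasurable (Filter.Eventually.of_forall fun ω => by
        rw [Real.norm_of_nonneg (Real.exp_pos _).le]
        exact hpt ω)
    refine ⟨hexpint, ?_⟩
    have h3 := integral_mono hexpint hI hpt
    rw [integral_const_mul] at h3
    rw [mgf]
    refine h3.trans ?_
    have h4 : 1 + 1 / 2 ≤ Real.exp (l ^ 2 * t ^ 2 / 2) := by
      linarith [Real.add_one_le_exp (l ^ 2 * t ^ 2 / 2)]
    calc _ ≤ Real.exp (l ^ 2 * t ^ 2 / 2) * Real.exp (l ^ 2 * t ^ 2 / 2) :=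
          mul_le_mul_of_nonneg_left ((hEbound _ (by norm_num)).trans h4) (Real.exp_pos _).le
      _ = _ := by
          rw [← Real.exp_add]
          ring_nf

/-- A centred variable of bounded sub-Gaussian norm has a sub-Gaussian moment generating
function. -/
theorem hasSubgaussianMGF_of_psiTwoNorm_le [IsProbabilityMeasure P] {X : Ω → ℝ}
    (hX : Measurable X) (hmean : ∫ ω, X ω ∂P = 0) {τ : ℝ} (hτ : 0 ≤ τ)
    (h : psiTwoNorm X P ≤ ENNReal.ofReal τ) :
    HasSubgaussianMGF X (2 * τ ^ 2).toNNReal P := by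
  have hlt : ∀ t, τ < t → psiTwoNorm X P < ENNReal.ofReal t := fun t ht =>
    h.trans_lt ((ENNReal.ofReal_lt_ofReal_iff (hτ.trans_lt ht)).2 ht)
  refine ⟨fun l => (mgf_le_of_psiTwoNorm_lt hX hmean (by linarith : 0 < τ + 1)
    (hlt _ (by linarith)) l).1, fun l => ?_⟩
  rw [Real.coe_toNNReal _ (by positivity),
    show 2 * τ ^ 2 * l ^ 2 / 2 = l ^ 2 * τ ^ 2 by ring]
  -- The moment bound is available only for t strictly above the norm, so t decreases to τ; this
  -- includes τ = 0.
  have hlim : Filter.Tendsto (fun t => Real.exp (l ^ 2 * t ^ 2)) (nhdsWithin τ (Set.Ioi τ))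
      (nhds (Real.exp (l ^ 2 * τ ^ 2))) :=
    (by fun_prop : Continuous fun t => Real.exp (l ^ 2 * t ^ 2)).continuousAt.continuousWithinAt
  refine ge_of_tendsto hlim ?_
  filter_upwards [self_mem_nhdsWithin] with t ht
  exact (mgf_le_of_psiTwoNorm_lt hX hmean (hτ.trans_lt ht) (hlt t ht) l).2

/-- Tail of a weighted sum of independent centred sub-Gaussian variables. -/
theorem measureReal_weighted_sum_tail_le [IsProbabilityMeasure P] {κ : Type*} [Fintype κ]
    {X : κ → Ω → ℝ} (hX : ∀ k, Measurable (X k)) (hind : iIndepFun X P)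
    (hmean : ∀ k, ∫ ω, X k ω ∂P = 0) {τ : ℝ} (hτ : 0 ≤ τ)
    (hpsi : ∀ k, psiTwoNorm (X k) P ≤ ENNReal.ofReal τ) {c : κ → ℝ} {b : ℝ} (hb : 0 ≤ b)
    (hc : ∑ k, c k ^ 2 ≤ b ^ 2) {x : ℝ} (hx : 0 ≤ x) :
    P.real {ω | x * (τ * b) < ∑ k, c k * X k ω} ≤ Real.exp (-(x ^ 2 / 4)) := by
  have hterm : ∀ k, HasSubgaussianMGF (fun ω => c k * X k ω)
      (c k ^ 2 * (2 * τ ^ 2)).toNNReal P := by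
    intro k
    rw [Real.toNNReal_mul (sq_nonneg _), Real.toNNReal_of_nonneg (sq_nonneg (c k))]
    exact (hasSubgaussianMGF_of_psiTwoNorm_le (hX k) (hmean k) hτ (hpsi k)).const_mul (c k)
  have hsub := HasSubgaussianMGF.sum_of_iIndepFun (s := Finset.univ)
    (hind.comp (fun k y => c k * y) fun k => by fun_prop) fun k _ => hterm k
  simp only [Function.comp_apply] at hsub
  set v : NNReal := ∑ k, (c k ^ 2 * (2 * τ ^ 2)).toNNReal with hv
  have hvr : (v : ℝ) ≤ 2 * (τ * b) ^ 2 := by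
    have e : (v : ℝ) = ∑ k, c k ^ 2 * (2 * τ ^ 2) := by
      rw [hv, NNReal.coe_sum]
      exact Finset.sum_congr rfl fun k _ => Real.coe_toNNReal _ (by positivity)
    rw [e, ← Finset.sum_mul]
    have := mul_le_mul_of_nonneg_right hc (by positivity : 0 ≤ 2 * τ ^ 2)
    linarith
  -- With zero variance proxy the sum vanishes almost surely, and the strict inequality in the event
  -- makes it null.
  rcases eq_or_ne v 0 with h0 | h0
  · rw [h0] at hsub
    have hz := hsub.ae_eq_zero_of_hasSubgaussianMGF_zero
    have : P.real {ω | x * (τ * b) < ∑ k, c k * X k ω} = 0 := by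
      rw [measureReal_eq_zero_iff]
      rw [Filter.EventuallyEq, ae_iff] at hz
      refine measure_mono_null (fun ω hω => ?_) hz
      simp only [Set.mem_ofPred_eq, Pi.zero_apply] at hω ⊢
      have : 0 ≤ x * (τ * b) := by positivity
      exact (this.trans_lt hω).ne'
    rw [this]
    positivity
  · have hvpos : (0 : ℝ) < v := by
      have := pos_iff_ne_zero.2 h0
      exact_mod_cast this
    have h1 := hsub.measure_ge_le (ε := x * (τ * b)) (by positivity)
    have hss : {ω | x * (τ * b) < ∑ k, c k * X k ω} ⊆ {ω | x * (τ * b) ≤ ∑ k, c k * X k ω} :=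
      fun ω hω => by
        rw [Set.mem_ofPred_eq] at hω ⊢
        exact hω.le
    refine (measureReal_mono hss).trans (h1.trans (Real.exp_le_exp.2 ?_))
    rw [neg_div, neg_le_neg_iff, le_div_iff₀ (by positivity)]
    nlinarith [sq_nonneg x]

end SubGaussian

/-! ### Transfer to the probability space and the uniform noise bound. -/

section Patterns

variable {m n : ℕ} {Ω : Type*} [MeasurableSpace Ω] {P : Measure Ω}

/-- The pattern of a mask. -/
noncomputable def maskPattern (M : Matrix (Fin m) (Fin n) ℝ) (k : Fin m × Fin n) : Bool :=
  decide (M k.1 k.2 = 1)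

/-- The mask of a pattern. -/
def patternMask (S : Fin m × Fin n → Bool) : Matrix (Fin m) (Fin n) ℝ :=
  Matrix.of fun i j => if S (i, j) then 1 else 0

theorem patternMask_isMask (S : Fin m × Fin n → Bool) : IsMask (patternMask S) := by
  intro i j
  simp only [patternMask, Matrix.of_apply]
  split_ifs <;> simp

theorem patternMask_maskPattern {M : Matrix (Fin m) (Fin n) ℝ} (hM : IsMask M) :
    patternMask (maskPattern M) = M := by
  ext i j
  simp only [patternMask, maskPattern, Matrix.of_apply, decide_eq_true_eq]
  rcases hM i j with h | h <;> simp [h]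

theorem maskPattern_eq_iff {M : Matrix (Fin m) (Fin n) ℝ} (hM : IsMask M)
    (S : Fin m × Fin n → Bool) :
    maskPattern M = S ↔ ∀ k : Fin m × Fin n, M k.1 k.2 = if S k then 1 else 0 := by
  constructor
  · rintro rfl k
    rw [← congrFun (congrFun (patternMask_maskPattern hM) k.1) k.2]
    simp [patternMask, maskPattern]
  · intro h
    funext k
    rw [maskPattern, h k]
    cases S k <;> simp

variable [IsProbabilityMeasure P] {T : Ω → Matrix (Fin m) (Fin n) ℝ}
  {prob : Matrix (Fin m) (Fin n) ℝ}

theorem measureReal_maskPattern_eq (hTm : ∀ i j, Measurable fun ω => T ω i j)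
    (hT : ∀ ω, IsMask (T ω)) (hprob : ∀ i j, P.real {ω | T ω i j = 1} = prob i j)
    (hind : iIndepFun (fun (p : Fin m × Fin n) ω => T ω p.1 p.2) P)
    (S : Fin m × Fin n → Bool) :
    P.real {ω | maskPattern (T ω) = S} = bernWeight (fun k => prob k.1 k.2) S := by
  have e : {ω | maskPattern (T ω) = S} = ⋂ k ∈ (Finset.univ : Finset (Fin m × Fin n)),
      (fun ω => T ω k.1 k.2) ⁻¹' {if S k then 1 else 0} := by
    ext ω
    simp only [Set.mem_ofPred_eq, maskPattern_eq_iff (hT ω) S, Finset.mem_univ, Set.iInter_true,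
      Set.mem_iInter, Set.mem_preimage, Set.mem_singleton_iff]
  have h := hind.measure_inter_preimage_eq_mul Finset.univ
    (sets := fun k => {if S k then (1 : ℝ) else 0}) fun k _ => measurableSet_singleton _
  rw [measureReal_def, e, h, ENNReal.toReal_prod, bernWeight]
  refine Finset.prod_congr rfl fun k _ => ?_
  have hmeas : MeasurableSet {ω | T ω k.1 k.2 = 1} := hTm k.1 k.2 (measurableSet_singleton 1)
  cases hk : S k with
  | true =>
    simp only [if_true]
    exact hprob k.1 k.2
  | false =>
    simp only [Bool.false_eq_true, if_false]
    rw [← hprob k.1 k.2, ← probReal_compl_eq_one_sub hmeas, measureReal_def]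
    congr 2
    ext ω
    simp only [Set.mem_preimage, Set.mem_singleton_iff, Set.mem_compl_iff, Set.mem_ofPred_eq]
    rcases hT ω k.1 k.2 with h | h <;> simp [h]

theorem measureReal_pattern_le (hTm : ∀ i j, Measurable fun ω => T ω i j)
    (hT : ∀ ω, IsMask (T ω)) (hprob : ∀ i j, P.real {ω | T ω i j = 1} = prob i j)
    (hind : iIndepFun (fun (p : Fin m × Fin n) ω => T ω p.1 p.2) P)
    (B : (Fin m × Fin n → Bool) → Prop) [DecidablePred B] :
    P.real {ω | B (maskPattern (T ω))} ≤
      bernExp (fun k => prob k.1 k.2) fun S => if B S then 1 else 0 := by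
  have e : {ω | B (maskPattern (T ω))} = ⋃ S : Fin m × Fin n → Bool,
      {ω | maskPattern (T ω) = S ∧ B S} := by
    ext ω
    simp
  rw [e]
  refine (measureReal_iUnion_fintype_le _).trans (Finset.sum_le_sum fun S _ => ?_)
  rw [← measureReal_maskPattern_eq hTm hT hprob hind S]
  by_cases hB : B S <;> simp [hB]

/-- The weighted noise is uniformly small over sign vectors. -/
theorem measureReal_noise_le {ε : Ω → Matrix (Fin m) (Fin n) ℝ}
    (hTm : ∀ i j, Measurable fun ω => T ω i j)
    (hT : ∀ ω, IsMask (T ω)) (hprob : ∀ i j, P.real {ω | T ω i j = 1} = prob i j)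
    (hind : iIndepFun (fun (p : Fin m × Fin n) ω => T ω p.1 p.2) P)
    (hεm : ∀ i j, Measurable fun ω => ε ω i j)
    (hεind : iIndepFun (fun (p : Fin m × Fin n) ω => ε ω p.1 p.2) P)
    (hmean : ∀ i j, ∫ ω, ε ω i j ∂P = 0) {τ : ℝ} (hτ : 0 ≤ τ)
    (hpsi : ∀ i j, psiTwoNorm (fun ω => ε ω i j) P ≤ ENNReal.ofReal τ)
    (hindep : IndepFun (fun ω (p : Fin m × Fin n) => T ω p.1 p.2)
        (fun ω (p : Fin m × Fin n) => ε ω p.1 p.2) P)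
    {b : ℝ} (hb : 0 ≤ b) (R : (Fin m × Fin n → Bool) → Fin m × Fin n → ℝ)
    (hR : ∀ S, ∑ k, R S k ^ 2 ≤ b ^ 2) :
    P.real {ω | ∃ (s : Fin m → Bool) (t : Fin n → Bool),
      3 * Real.sqrt ((m : ℝ) + n) * (τ * b) < ∑ k : Fin m × Fin n,
        (R (maskPattern (T ω)) k * (boolSign (s k.1) * boolSign (t k.2))) * ε ω k.1 k.2} ≤
      Real.exp (-((m : ℝ) + n)) := by
  set d : ℝ := (m : ℝ) + n with hd
  have hd0 : 0 ≤ d := by positivity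
  set x : ℝ := 3 * Real.sqrt d
  set Bad : (Fin m × Fin n → Bool) → Set (Fin m × Fin n → ℝ) := fun S =>
    ⋃ (st : (Fin m → Bool) × (Fin n → Bool)), {y | x * (τ * b) < ∑ k : Fin m × Fin n,
      (R S k * (boolSign (st.1 k.1) * boolSign (st.2 k.2))) * y k} with hBad
  have hBadm : ∀ S, MeasurableSet (Bad S) := fun S =>
    MeasurableSet.iUnion fun st => measurableSet_lt measurable_const (by fun_prop)
  have hBadP : ∀ S, P.real ((fun ω (p : Fin m × Fin n) => ε ω p.1 p.2) ⁻¹' Bad S) ≤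
      Real.exp (-d) := by
    intro S
    rw [hBad, Set.preimage_iUnion]
    refine (measureReal_iUnion_fintype_le _).trans ?_
    have hterm : ∀ st : (Fin m → Bool) × (Fin n → Bool),
        P.real ((fun ω (p : Fin m × Fin n) => ε ω p.1 p.2) ⁻¹' {y | x * (τ * b) <
          ∑ k : Fin m × Fin n, (R S k * (boolSign (st.1 k.1) * boolSign (st.2 k.2))) * y k}) ≤
        Real.exp (-(9 / 4 * d)) := by
      intro st
      have h := measureReal_weighted_sum_tail_le (X := fun (k : Fin m × Fin n) ω => ε ω k.1 k.2)
        (fun k => hεm k.1 k.2) hεind (fun k => hmean k.1 k.2) hτ (fun k => hpsi k.1 k.2)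
        (c := fun k => R S k * (boolSign (st.1 k.1) * boolSign (st.2 k.2))) hb
        (by simpa only [mul_pow, boolSign_sq, mul_one] using hR S) (x := x) (by positivity)
      refine h.trans (Real.exp_le_exp.2 (le_of_eq ?_))
      simp only [x]
      rw [mul_pow, Real.sq_sqrt hd0]
      ring
    refine (Finset.sum_le_sum fun st _ => hterm st).trans ?_
    -- Each sign pair has tail exp(−9d/4), and the 2^(m+n) pairs cost at most exp(5d/4), which
    -- leaves exp(−d).
    have h2 : (2 : ℝ) ≤ Real.exp (5 / 4) := by
      have := Real.add_one_le_exp (5 / 4)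
      linarith
    have h3 : (2 : ℝ) ^ (m + n) ≤ Real.exp (5 / 4 * d) := by
      have := pow_le_pow_left₀ (by norm_num) h2 (m + n)
      rw [← Real.exp_nat_mul] at this
      rw [hd, mul_comm]
      exact_mod_cast this
    calc _ = (2 : ℝ) ^ (m + n) * Real.exp (-(9 / 4 * d)) := by
          simp [pow_add]
      _ ≤ Real.exp (5 / 4 * d) * Real.exp (-(9 / 4 * d)) := by gcongr
      _ = Real.exp (-d) := by
          rw [← Real.exp_add]
          ring_nf
  set TT : Ω → Fin m × Fin n → ℝ := fun ω p => T ω p.1 p.2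
  have hsub : {ω | ∃ (s : Fin m → Bool) (t : Fin n → Bool),
      x * (τ * b) < ∑ k : Fin m × Fin n,
        (R (maskPattern (T ω)) k * (boolSign (s k.1) * boolSign (t k.2))) * ε ω k.1 k.2} ⊆
      ⋃ S : Fin m × Fin n → Bool, TT ⁻¹' {fun k => if S k then 1 else 0} ∩
        (fun ω (p : Fin m × Fin n) => ε ω p.1 p.2) ⁻¹' Bad S := by
    rintro ω ⟨s, t, hst⟩
    refine Set.mem_iUnion.2 ⟨maskPattern (T ω), ?_, ?_⟩
    · exact funext fun k => (maskPattern_eq_iff (hT ω) _).1 rfl k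
    · exact Set.mem_iUnion.2 ⟨(s, t), hst⟩
  refine (measureReal_mono hsub).trans ((measureReal_iUnion_fintype_le _).trans ?_)
  -- Conditioning on the pattern: once S is fixed the coefficients are deterministic, and
  -- independence of T and ε splits the probability.
  have hS : ∀ S : Fin m × Fin n → Bool, P.real (TT ⁻¹' {fun k => if S k then 1 else 0} ∩
      (fun ω (p : Fin m × Fin n) => ε ω p.1 p.2) ⁻¹' Bad S) ≤
      bernWeight (fun k => prob k.1 k.2) S * Real.exp (-d) := by
    intro S
    have e : TT ⁻¹' {fun k => if S k then 1 else 0} = {ω | maskPattern (T ω) = S} := by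
      ext ω
      simp only [Set.mem_preimage, Set.mem_singleton_iff, Set.mem_ofPred_eq,
        maskPattern_eq_iff (hT ω) S]
      exact funext_iff
    rw [measureReal_def, hindep.measure_inter_preimage_eq_mul _ _ (measurableSet_singleton _)
      (hBadm S), ENNReal.toReal_mul, ← measureReal_def, ← measureReal_def, e,
      measureReal_maskPattern_eq hTm hT hprob hind S]
    refine mul_le_mul_of_nonneg_left (hBadP S) ?_
    rw [← measureReal_maskPattern_eq hTm hT hprob hind S]
    exact measureReal_nonneg
  refine (Finset.sum_le_sum fun S _ => hS S).trans (le_of_eq ?_)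
  exact bernExp_const (fun k : Fin m × Fin n => prob k.1 k.2) (Real.exp (-d))

end Patterns

/-! ### Deterministic error bound for the estimator. -/

section Estimator

variable {m n : ℕ}

theorem frobNorm_sq (A : Matrix (Fin m) (Fin n) ℝ) : frobNorm A ^ 2 = ∑ i, ∑ j, A i j ^ 2 :=
  Real.sq_sqrt (Finset.sum_nonneg fun _ _ => Finset.sum_nonneg fun _ _ => sq_nonneg _)

/-- The basic inequality for the weighted estimator. -/
theorem IsEstimator.basic_inequality (hm : 0 < m) (hn : 0 < n) {β μ : ℝ}
    {T W ε Astar Ahat : Matrix (Fin m) (Fin n) ℝ} (hT : IsMask T) (hW : ∀ i j, 1 ≤ W i j)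
    (hμ : 0 ≤ μ) (hstar : maxNorm Astar ≤ β) (h : IsEstimator β μ T W (Astar + ε) Ahat) :
    frobNorm (Ahat - Astar) ^ 2 ≤
      -∑ i, ∑ j, (T ⊙ W - Matrix.of fun _ _ => 1 : Matrix (Fin m) (Fin n) ℝ) i j * (Ahat i j - Astar i j) ^ 2 +
      2 * ∑ i, ∑ j, (T i j * W i j * ε i j) * (Ahat i j - Astar i j) +
      (m : ℝ) * n * (μ * nuclearNorm Astar) := by
  have hN : (0 : ℝ) < (m : ℝ) * n := by positivity
  have hfrob : ∀ A : Matrix (Fin m) (Fin n) ℝ,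
      frobNorm (T ⊙ W.map Real.sqrt ⊙ (Astar + ε - A)) ^ 2 =
      ∑ i, ∑ j, T i j * W i j * (Astar i j + ε i j - A i j) ^ 2 := by
    intro A
    rw [frobNorm_sq]
    refine Finset.sum_congr rfl fun i _ => Finset.sum_congr rfl fun j _ => ?_
    simp only [Matrix.hadamard_apply, Matrix.map_apply, Matrix.sub_apply, Matrix.add_apply,
      mul_pow]
    rw [Real.sq_sqrt (zero_le_one.trans (hW i j))]
    rcases hT i j with h0 | h0 <;> simp [h0]
  have hmin : objective μ T W (Astar + ε) Ahat ≤ objective μ T W (Astar + ε) Astar :=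
    isMinOn_iff.1 h.2 Astar hstar
  simp only [objective, hfrob] at hmin
  have hnuc : 0 ≤ μ * nuclearNorm Ahat := mul_nonneg hμ (nuclearNorm_nonneg _)
  set X := ∑ i, ∑ j, T i j * W i j * (Astar i j + ε i j - Ahat i j) ^ 2
  set Y := ∑ i, ∑ j, T i j * W i j * (Astar i j + ε i j - Astar i j) ^ 2
  have h1 : X ≤ Y + (m : ℝ) * n * (μ * nuclearNorm Astar) := by
    have h2 : X / ((m : ℝ) * n) ≤ Y / ((m : ℝ) * n) + μ * nuclearNorm Astar := by linarith
    have h3 := mul_le_mul_of_nonneg_left h2 hN.le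
    rw [mul_add, mul_div_cancel₀ _ hN.ne', mul_div_cancel₀ _ hN.ne'] at h3
    exact h3
  have h4 : frobNorm (Ahat - Astar) ^ 2 =
      -∑ i, ∑ j, (T ⊙ W - Matrix.of fun _ _ => 1 : Matrix (Fin m) (Fin n) ℝ) i j * (Ahat i j - Astar i j) ^ 2 +
      2 * ∑ i, ∑ j, (T i j * W i j * ε i j) * (Ahat i j - Astar i j) + (X - Y) := by
    rw [frobNorm_sq]
    simp only [X, Y, Finset.mul_sum, ← Finset.sum_neg_distrib, ← Finset.sum_sub_distrib,
      ← Finset.sum_add_distrib]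
    refine Finset.sum_congr rfl fun i _ => Finset.sum_congr rfl fun j _ => ?_
    simp only [Matrix.sub_apply, Matrix.hadamard_apply, Matrix.of_apply]
    ring
  linarith

theorem boolSign_not (b : Bool) : boolSign (!b) = -boolSign b := by cases b <;> simp [boolSign]

/-- Flipping all row signs gives the same bound for −G, so A and −B are each paired at cost 162 b β.
-/
theorem pairing_sub_le_of_signs {G A B : Matrix (Fin m) (Fin n) ℝ} {b β : ℝ} (hb : 0 ≤ b)
    (h : ∀ (s : Fin m → Bool) (t : Fin n → Bool),
      ∑ i, ∑ j, G i j * (boolSign (s i) * boolSign (t j)) ≤ b) (hA : maxNorm A ≤ β)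
    (hB : maxNorm B ≤ β) :
    ∑ i, ∑ j, G i j * (A i j - B i j) ≤ 324 * b * β := by
  have h1 := pairing_le_of_signs hb h hA
  have h2 := pairing_le_of_signs (G := -G) hb (fun s t => by
    refine le_trans (le_of_eq ?_) (h (fun i => !s i) t)
    refine Finset.sum_congr rfl fun i _ => Finset.sum_congr rfl fun j _ => ?_
    rw [boolSign_not, Matrix.neg_apply]
    ring) hB
  have e : ∑ i, ∑ j, G i j * (A i j - B i j) =
      ∑ i, ∑ j, G i j * A i j + ∑ i, ∑ j, (-G) i j * B i j := by
    simp only [← Finset.sum_add_distrib, Matrix.neg_apply]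
    exact Finset.sum_congr rfl fun i _ => Finset.sum_congr rfl fun j _ => by ring
  linarith

/-- The error bound given the balancing error and the size of the weighted noise. -/
theorem IsEstimator.error_le (hm : 0 < m) (hn : 0 < n) {β μ : ℝ}
    {T W ε Astar Ahat : Matrix (Fin m) (Fin n) ℝ} (hT : IsMask T) (hW : ∀ i j, 1 ≤ W i j)
    (hμ : 0 ≤ μ) (hstar : maxNorm Astar ≤ β) (h : IsEstimator β μ T W (Astar + ε) Ahat)
    {ρ K b : ℝ} (hbal : opNorm (T ⊙ W - Matrix.of fun _ _ => 1) ≤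
      25 * Real.sqrt ((m : ℝ) * n) * ρ) (hb : 0 ≤ b)
    (hnoise : ∀ (s : Fin m → Bool) (t : Fin n → Bool),
      ∑ i, ∑ j, (T i j * W i j * ε i j) * (boolSign (s i) * boolSign (t j)) ≤ b)
    (hμK : μ ≤ K * β * ρ / Real.sqrt ((m : ℝ) * n)) :
    frobNorm (Ahat - Astar) ^ 2 / ((m : ℝ) * n) ≤
      (100 + K) * β ^ 2 * ρ + 648 * b * β / ((m : ℝ) * n) := by
  have hN : (0 : ℝ) < (m : ℝ) * n := by positivity
  have hβ : 0 ≤ β := (maxNorm_nonneg _).trans hstar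
  have h1 := h.basic_inequality hm hn hT hW hμ hstar
  have h2 := pairing_hadamard_sub_sq_le (T ⊙ W - Matrix.of fun _ _ => 1) h.1 hstar
  have h3 := pairing_sub_le_of_signs (G := Matrix.of fun i j => T i j * W i j * ε i j) hb hnoise
    h.1 hstar
  simp only [Matrix.of_apply] at h3
  have h4 := nuclearNorm_le_of_maxNorm_le hstar
  set N : ℝ := (m : ℝ) * n
  set s := Real.sqrt N with hs
  have hspos : 0 < s := Real.sqrt_pos.2 hN
  have hss : s * s = N := Real.mul_self_sqrt hN.le
  have h5 : opNorm (T ⊙ W - Matrix.of fun _ _ => 1) * s * β ^ 2 ≤ 25 * (N * ρ * β ^ 2) := by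
    have := mul_le_mul_of_nonneg_right hbal (by positivity : 0 ≤ s * β ^ 2)
    calc _ = opNorm (T ⊙ W - Matrix.of fun _ _ => 1) * (s * β ^ 2) := by ring
      _ ≤ 25 * s * ρ * (s * β ^ 2) := this
      _ = 25 * ((s * s) * ρ * β ^ 2) := by ring
      _ = _ := by rw [hss]
  have h6 : N * (μ * nuclearNorm Astar) ≤ N * (K * β ^ 2 * ρ) := by
    refine mul_le_mul_of_nonneg_left ?_ hN.le
    calc μ * nuclearNorm Astar ≤ μ * (s * β) := mul_le_mul_of_nonneg_left h4 hμ
      _ ≤ K * β * ρ / s * (s * β) := mul_le_mul_of_nonneg_right hμK (by positivity)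
      _ = K * β ^ 2 * ρ := by
          field_simp
  rw [div_le_iff₀ hN]
  have e : ((100 + K) * β ^ 2 * ρ + 648 * b * β / N) * N =
      4 * (25 * (N * ρ * β ^ 2)) + N * (K * β ^ 2 * ρ) + 648 * b * β := by
    field_simp
    ring
  rw [e]
  linarith

theorem frobNorm_sub_sq_le {A B : Matrix (Fin m) (Fin n) ℝ} {β : ℝ} (hA : maxNorm A ≤ β)
    (hB : maxNorm B ≤ β) : frobNorm (A - B) ^ 2 ≤ (m : ℝ) * n * (4 * β ^ 2) := by
  rw [frobNorm_sq]
  calc ∑ i, ∑ j, (A - B) i j ^ 2 ≤ ∑ _i : Fin m, ∑ _j : Fin n, 4 * β ^ 2 := by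
        refine Finset.sum_le_sum fun i _ => Finset.sum_le_sum fun j _ => ?_
        have h1 := abs_le.1 (abs_apply_le_of_maxNorm_le hA i j)
        have h2 := abs_le.1 (abs_apply_le_of_maxNorm_le hB i j)
        rw [Matrix.sub_apply]
        nlinarith
    _ = (m : ℝ) * n * (4 * β ^ 2) := by
        simp
        ring

theorem patternMask_hadamard_sub (q : Fin m × Fin n → ℝ) (S : Fin m × Fin n → Bool) :
    patternMask S ⊙ (Matrix.of fun i j => (q (i, j))⁻¹) - Matrix.of (fun _ _ => 1) =
      devMatrix q S := by
  ext i j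
  simp [patternMask, devMatrix, bernDev]

theorem inv_mem_feasibleWeights {κ : ℝ} {q : Fin m × Fin n → ℝ} (h0 : ∀ k, 0 < q k)
    (h1 : ∀ k, q k ≤ 1) (hκ : Real.sqrt (2 * ∑ k, (q k)⁻¹) ≤ κ) {S : Fin m × Fin n → Bool}
    (hS : ∑ k, (if S k then ((q k)⁻¹) ^ 2 else 0) ≤ 2 * ∑ k, (q k)⁻¹) :
    (Matrix.of fun i j => (q (i, j))⁻¹) ∈ feasibleWeights κ (patternMask S) := by
  refine ⟨le_trans (Real.sqrt_le_sqrt ?_) hκ, fun i j => (one_le_inv₀ (h0 _)).2 (h1 _)⟩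
  refine le_trans (le_of_eq ?_) hS
  rw [Fintype.sum_prod_type]
  refine Finset.sum_congr rfl fun i _ => Finset.sum_congr rfl fun j _ => ?_
  simp only [patternMask, Matrix.hadamard_apply, Matrix.of_apply]
  split_ifs <;> simp

/-- If the rate is below `1`, the inverse probability weights balance the pattern at that rate. -/
theorem bernExp_balance_le (hm : 0 < m) (hn : 0 < n) {q : Fin m × Fin n → ℝ} {ρ : ℝ}
    (hρ : 0 < ρ) (h0 : ∀ k, ρ ≤ q k) (h1 : ∀ k, q k ≤ 1) (hrate : rate m n ρ < 1) :
    bernExp q (fun S => if 25 * Real.sqrt ((m : ℝ) * n) * rate m n ρ <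
      opNorm (devMatrix q S) then 1 else 0) ≤ 1 / ((m : ℝ) + n) := by
  have hm1 : (1 : ℝ) ≤ m := by exact_mod_cast hm
  have hn1 : (1 : ℝ) ≤ n := by exact_mod_cast hn
  have hq : ∀ k, 0 ≤ q k := fun k => hρ.le.trans (h0 k)
  have hmono : ∀ a : ℝ, a ≤ 25 * Real.sqrt ((m : ℝ) * n) * rate m n ρ →
      bernExp q (fun S => if 25 * Real.sqrt ((m : ℝ) * n) * rate m n ρ <
        opNorm (devMatrix q S) then 1 else 0) ≤
      bernExp q (fun S => if a < opNorm (devMatrix q S) then 1 else 0) := by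
    intro a ha
    refine bernExp_mono hq h1 fun S => ?_
    split_ifs with h2 h3
    · exact le_rfl
    · exact absurd (ha.trans_lt h2) h3
    · exact zero_le_one
    · exact le_rfl
  set lo : ℝ := min (m : ℝ) n
  set hi : ℝ := max (m : ℝ) n with hhi
  have hlo : 0 < lo := lt_min (by linarith) (by linarith)
  have hhi0 : 0 < hi := lt_max_of_lt_left (by linarith)
  have hprod : (m : ℝ) * n = lo * hi := (min_mul_max _ _).symm
  have hlog : 0 < Real.log ((m : ℝ) + n) := Real.log_pos (by linarith)
  rcases le_total (Real.sqrt (Real.log ((m : ℝ) + n)) / Real.sqrt (ρ * lo))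
    (Real.sqrt ((m : ℝ) + n) / (ρ * Real.sqrt ((m : ℝ) * n))) with hle | hle
  · have hr : rate m n ρ = Real.sqrt (Real.log ((m : ℝ) + n)) / Real.sqrt (ρ * lo) :=
      min_eq_left hle
    -- This is where a rate below 1 is needed: it gives the logarithmic sampling condition of the
    -- moment bound.
    have hlogle : Real.log ((m : ℝ) + n) ≤ ρ * lo := by
      rw [hr, div_lt_one (by positivity)] at hrate
      exact ((Real.sqrt_lt_sqrt_iff hlog.le).1 hrate).le
    refine (hmono _ (le_of_eq ?_)).trans
      (bernExp_opNorm_devMatrix_moment hm hn hρ h0 h1 hlogle)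
    rw [hr, mul_assoc, ← mul_div_assoc, hprod, ← Real.sqrt_mul (by positivity),
      ← Real.sqrt_div (by positivity), ← hhi]
    congr 2
    field_simp
  · have hr : rate m n ρ = Real.sqrt ((m : ℝ) + n) / (ρ * Real.sqrt ((m : ℝ) * n)) :=
      min_eq_right hle
    refine (hmono _ ?_).trans (bernExp_opNorm_devMatrix_net hm hρ h0 h1)
    have hs : 0 < Real.sqrt ((m : ℝ) * n) := by positivity
    have e : 25 * Real.sqrt ((m : ℝ) * n) * rate m n ρ =
        25 * (Real.sqrt ((m : ℝ) + n) / ρ) := by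
      rw [hr]
      field_simp
    rw [e]
    have : 0 ≤ Real.sqrt ((m : ℝ) + n) / ρ := by positivity
    linarith

end Estimator

end MatrixCompletion

/-! ### Assembly of the three exceptional events. -/

theorem mainTheorem1 :
    ∃ C C' : ℝ, 0 < C ∧ 0 < C' ∧
      ∀ (n₁ n₂ : ℕ), 0 < n₁ → 0 < n₂ →
      ∀ {Ω : Type*} [MeasurableSpace Ω] (P : Measure Ω) [IsProbabilityMeasure P]
        -- the observation indicators, their probabilities, the errors and the target
        (T ε : Ω → Matrix (Fin n₁) (Fin n₂) ℝ)
        (prob Astar : Matrix (Fin n₁) (Fin n₂) ℝ)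
        -- the selection of the balancing weights as a function of the indicators
        (What : Matrix (Fin n₁) (Fin n₂) ℝ → Matrix (Fin n₁) (Fin n₂) ℝ)
        (πL β τ κ μ K : ℝ),
      -- independent Bernoulli indicators with probabilities bounded below by `πL`
      (∀ i j, Measurable fun ω => T ω i j) →
      (∀ ω, MatrixCompletion.IsMask (T ω)) →
      (∀ i j, P.real {ω | T ω i j = 1} = prob i j) →
      0 < πL → (∀ i j, πL ≤ prob i j) →
      iIndepFun (fun (p : Fin n₁ × Fin n₂) ω => T ω p.1 p.2) P →
      -- independent centred sub-Gaussian errors, independent of the indicators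
      (∀ i j, Measurable fun ω => ε ω i j) →
      iIndepFun (fun (p : Fin n₁ × Fin n₂) ω => ε ω p.1 p.2) P →
      (∀ i j, ∫ ω, ε ω i j ∂P = 0) →
      0 ≤ τ →
      (∀ i j, MatrixCompletion.psiTwoNorm (fun ω => ε ω i j) P ≤ ENNReal.ofReal τ) →
      IndepFun (fun ω (p : Fin n₁ × Fin n₂) => T ω p.1 p.2)
        (fun ω (p : Fin n₁ × Fin n₂) => ε ω p.1 p.2) P →
      -- the target and the tuning parameters
      MatrixCompletion.maxNorm Astar ≤ β →
      Real.sqrt (2 * ∑ i, ∑ j, (prob i j)⁻¹) ≤ κ →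
      0 ≤ K → 0 ≤ μ →
      μ ≤ K * β * MatrixCompletion.rate n₁ n₂ πL / Real.sqrt ((n₁ : ℝ) * n₂) →
      (∀ M, MatrixCompletion.IsMask M → MatrixCompletion.IsBalancingWeight κ M (What M)) →
      ∃ E : Set Ω, MeasurableSet E ∧
        1 - Real.exp (-(Real.log 2 / 2 * πL ^ 2 * ∑ i, ∑ j, (prob i j)⁻¹))
            - 2 * Real.exp (-((n₁ : ℝ) + n₂)) - 1 / ((n₁ : ℝ) + n₂) ≤ P.real E ∧
        ∀ ω ∈ E, ∀ Ahat : Matrix (Fin n₁) (Fin n₂) ℝ,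
          MatrixCompletion.IsEstimator β μ (T ω) (What (T ω)) (Astar + ε ω) Ahat →
          MatrixCompletion.frobNorm (Ahat - Astar) ^ 2 / ((n₁ : ℝ) * n₂) ≤
            (C + K) * β ^ 2 * MatrixCompletion.rate n₁ n₂ πL +
              C' * β * τ * κ * Real.sqrt ((n₁ : ℝ) + n₂) / ((n₁ : ℝ) * n₂) := by
  -- 100 = 4 · 25 from balancing; 1944 = 2 · 324 · 3 from the noise, with 3 the tail level.
  refine ⟨100, 1944, by norm_num, by norm_num, ?_⟩
  intro n₁ n₂ hn₁ hn₂ Ω _ P _ T ε prob Astar What πL β τ κ μ K hTm hT hprob hπL hle hTind hεm hεind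
    hmean hτ hpsi hindep hstar hκ hK hμ hμK hWhat
  have hβ : 0 ≤ β := (MatrixCompletion.maxNorm_nonneg _).trans hstar
  have hκ0 : 0 ≤ κ := (Real.sqrt_nonneg _).trans hκ
  have hN : (0 : ℝ) < (n₁ : ℝ) * n₂ := by positivity
  set q : Fin n₁ × Fin n₂ → ℝ := fun k => prob k.1 k.2 with hq
  have hq0 : ∀ k, πL ≤ q k := fun k => hle _ _
  have hqpos : ∀ k, 0 < q k := fun k => hπL.trans_le (hq0 k)
  have hq1 : ∀ k, q k ≤ 1 := fun k => by
    have h := hprob k.1 k.2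
    exact h.symm.le.trans measureReal_le_one
  have hsum : ∑ i, ∑ j, (prob i j)⁻¹ = ∑ k, (q k)⁻¹ := by
    rw [Fintype.sum_prod_type]
  rw [hsum] at hκ ⊢
  rcases le_or_gt 1 (MatrixCompletion.rate n₁ n₂ πL) with hrate | hrate
  · refine ⟨Set.univ, MeasurableSet.univ, ?_, fun ω _ Ahat hA => ?_⟩
    · rw [probReal_univ]
      have h1 := Real.exp_pos (-(Real.log 2 / 2 * πL ^ 2 * ∑ k, (q k)⁻¹))
      have h2 := Real.exp_pos (-((n₁ : ℝ) + n₂))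
      have h3 : 0 < 1 / ((n₁ : ℝ) + n₂) := by positivity
      linarith
    · have h1 := MatrixCompletion.frobNorm_sub_sq_le hA.1 hstar
      have h2 : MatrixCompletion.frobNorm (Ahat - Astar) ^ 2 / ((n₁ : ℝ) * n₂) ≤ 4 * β ^ 2 := by
        rw [div_le_iff₀ hN]
        linarith
      have h3 : 0 ≤ 1944 * β * τ * κ * Real.sqrt ((n₁ : ℝ) + n₂) / ((n₁ : ℝ) * n₂) := by
        positivity
      have h4 : (100 + K) * β ^ 2 * 1 ≤
          (100 + K) * β ^ 2 * MatrixCompletion.rate n₁ n₂ πL :=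
        mul_le_mul_of_nonneg_left hrate (by positivity)
      have h5 : 0 ≤ K * β ^ 2 := by positivity
      nlinarith [sq_nonneg β]
  set R : (Fin n₁ × Fin n₂ → Bool) → Fin n₁ × Fin n₂ → ℝ := fun S k =>
    MatrixCompletion.patternMask S k.1 k.2 * What (MatrixCompletion.patternMask S) k.1 k.2 with hR
  have hRsq : ∀ S, ∑ k, R S k ^ 2 ≤ κ ^ 2 := by
    intro S
    have h1 := (hWhat _ (MatrixCompletion.patternMask_isMask S)).1.1
    have h2 := pow_le_pow_left₀ (Real.sqrt_nonneg _) h1 2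
    refine le_trans (le_of_eq ?_) h2
    have h3 := MatrixCompletion.frobNorm_sq
      (MatrixCompletion.patternMask S ⊙ What (MatrixCompletion.patternMask S))
    rw [MatrixCompletion.frobNorm] at h3
    rw [h3, Fintype.sum_prod_type]
    rfl
  set b : ℝ := 3 * Real.sqrt ((n₁ : ℝ) + n₂) * (τ * κ) with hb
  have hb0 : 0 ≤ b := by positivity
  classical
  set B₁ : Set Ω := {ω | 2 * ∑ k, (q k)⁻¹ < ∑ k,
    (if MatrixCompletion.maskPattern (T ω) k then ((q k)⁻¹) ^ 2 else 0)} with hB₁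
  set B₂ : Set Ω := {ω | 25 * Real.sqrt ((n₁ : ℝ) * n₂) * MatrixCompletion.rate n₁ n₂ πL <
    MatrixCompletion.opNorm (MatrixCompletion.devMatrix q (MatrixCompletion.maskPattern (T ω)))}
    with hB₂
  set B₃ : Set Ω := {ω | ∃ (s : Fin n₁ → Bool) (t : Fin n₂ → Bool), b < ∑ k : Fin n₁ × Fin n₂,
    (R (MatrixCompletion.maskPattern (T ω)) k *
      (MatrixCompletion.boolSign (s k.1) * MatrixCompletion.boolSign (t k.2))) * ε ω k.1 k.2}
    with hB₃
  have hP₁ : P.real B₁ ≤ Real.exp (-(Real.log 2 / 2 * πL ^ 2 * ∑ k, (q k)⁻¹)) :=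
    (MatrixCompletion.measureReal_pattern_le hTm hT hprob hTind fun S =>
      2 * ∑ k, (q k)⁻¹ < ∑ k, (if S k then ((q k)⁻¹) ^ 2 else 0)).trans
      (MatrixCompletion.bernExp_sum_inv_sq_tail_le hπL hq0 hq1)
  have hP₂ : P.real B₂ ≤ 1 / ((n₁ : ℝ) + n₂) :=
    (MatrixCompletion.measureReal_pattern_le hTm hT hprob hTind fun S =>
      25 * Real.sqrt ((n₁ : ℝ) * n₂) * MatrixCompletion.rate n₁ n₂ πL <
        MatrixCompletion.opNorm (MatrixCompletion.devMatrix q S)).trans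
      (MatrixCompletion.bernExp_balance_le hn₁ hn₂ hπL hq0 hq1 hrate)
  have hP₃ : P.real B₃ ≤ Real.exp (-((n₁ : ℝ) + n₂)) :=
    MatrixCompletion.measureReal_noise_le hTm hT hprob hTind hεm hεind hmean hτ hpsi hindep hκ0 R
      hRsq
  -- A measurable hull of the bad events has the same measure, so their measurability need not be
  -- checked. The noise uses only one of the two terms exp(−(n₁+n₂)) in the allowance.
  refine ⟨(toMeasurable P (B₁ ∪ B₂ ∪ B₃))ᶜ, (measurableSet_toMeasurable _ _).compl, ?_, ?_⟩
  · rw [probReal_compl_eq_one_sub (measurableSet_toMeasurable _ _), measureReal_def,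
      measure_toMeasurable, ← measureReal_def]
    have h1 := measureReal_union_le (μ := P) (B₁ ∪ B₂) B₃
    have h2 := measureReal_union_le (μ := P) B₁ B₂
    have h3 := Real.exp_pos (-((n₁ : ℝ) + n₂))
    linarith
  intro ω hω Ahat hA
  have hnot : ω ∉ B₁ ∪ B₂ ∪ B₃ := fun h => hω (subset_toMeasurable _ _ h)
  simp only [Set.mem_union, not_or] at hnot
  obtain ⟨⟨hω₁, hω₂⟩, hω₃⟩ := hnot
  simp only [hB₁, hB₂, hB₃, Set.mem_ofPred_eq, not_lt, not_exists] at hω₁ hω₂ hω₃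
  have hmask := MatrixCompletion.patternMask_maskPattern (hT ω)
  obtain ⟨hfeas, hopt⟩ := hWhat _ (hT ω)
  have hbal : MatrixCompletion.opNorm (T ω ⊙ What (T ω) - Matrix.of fun _ _ => 1) ≤
      25 * Real.sqrt ((n₁ : ℝ) * n₂) * MatrixCompletion.rate n₁ n₂ πL := by
    have hW₀ := MatrixCompletion.inv_mem_feasibleWeights hqpos hq1 hκ hω₁
    have h1 := MatrixCompletion.patternMask_hadamard_sub q (MatrixCompletion.maskPattern (T ω))
    rw [hmask] at hW₀ h1
    have h2 := isMinOn_iff.1 hopt _ hW₀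
    rw [h1] at h2
    exact h2.trans hω₂
  have hnoise : ∀ (s : Fin n₁ → Bool) (t : Fin n₂ → Bool),
      ∑ i, ∑ j, (T ω i j * What (T ω) i j * ε ω i j) *
        (MatrixCompletion.boolSign (s i) * MatrixCompletion.boolSign (t j)) ≤ b := by
    intro s t
    refine le_trans (le_of_eq ?_) (hω₃ s t)
    rw [Fintype.sum_prod_type]
    refine Finset.sum_congr rfl fun i _ => Finset.sum_congr rfl fun j _ => ?_
    simp only [hR, hmask]
    ring
  have hfin := hA.error_le hn₁ hn₂ (hT ω) hfeas.2 hμ hstar hbal hb0 hnoise hμK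
  refine hfin.trans (le_of_eq ?_)
  rw [hb]
  ring
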